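/- **The language.** Let $\mathsf{Ty}$ be the set of closed type expressions, modulo $\alpha$-equivalence, of the grammar $\tau ::= \alpha \mid \tau\boxplus\tau \mid \tau\boxtimes\tau \mid \tau\Rightarrow\tau \mid \mu\alpha.\tau$. Contexts are the objects $\Gamma\colon n\to\mathsf{Ty}$ of $\mathbb F/\mathsf{Ty}$ ($\mathbb F$ the category of finite cardinals and functions; $|\Gamma|=n$); morphisms are type-respecting renamings, and $\Gamma+\check\tau$ is $\Gamma$ extended by a variable of type $\tau$. Let $\mathcal C=(\mathbf{Set}^{\mathbb F/\mathsf{Ty}})^{\mathsf{Ty}}$. Nondeterministic FPC has the typed terms (modulo $\alpha$-equivalence) built from variables, choice $t\oplus s$, application $t\,s$, abstraction $\mathsf{lam}\,x{:}\tau.\,t$, $\mathsf{inl}$, $\mathsf{inr}$, $\mathsf{case}(t,s,r)$ (with $t:\tau_1\boxplus\tau_2$, $s:\tau_1\Rightarrow\tau$, $r:\tau_2\Rightarrow\tau$), $\mathsf{pair}$, $\mathsf{fst}$, $\mathsf{snd}$, $\mathsf{fold}:\tau[\mu\alpha.\tau/\alpha]\to\mu\alpha.\tau$ and $\mathsf{unfold}:\mu\alpha.\tau\to\tau[\mu\alpha.\tau/\alpha]$.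 Let $\Sigma\colon\mathcal C\to\mathcal C$ be the functor of this binding signature (one summand per operation, variables included; the summand of $\mathsf{lam}$ in sort $\tau_1\Rightarrow\tau_2$ is $X_{\tau_2}(-+\check\tau_1)$), and let $\iota\colon\Sigma\Lambda\to\Lambda$ be the algebra of terms, $\Lambda_\tau(\Gamma)=\{t\mid\Gamma\vdash t:\tau\}$. Call-by-name reduction $\to$ on (open) terms is generated by $$(\mathsf{lam}\,x.t)\,s\to t[s/x],\quad \mathsf{unfold}(\mathsf{fold}(t))\to t,\quad \mathsf{fst}(\mathsf{pair}(t,s))\to t,\quad \mathsf{snd}(\mathsf{pair}(t,s))\to s,\quad t\oplus s\to t,\quad t\oplus s\to s,$$ $$\mathsf{case}(\mathsf{inl}(t),s,r)\to s\,t,\quad \mathsf{case}(\mathsf{inr}(t),s,r)\to r\,t,$$ and closure under the evaluation contexts $(-)\,s$, $\mathsf{unfold}(-)$, $\mathsf{fst}(-)$, $\mathsf{snd}(-)$, $\mathsf{case}(-,s,r)$. Write $\Rightarrow^{*}$ for the reflexive transitive hull of $\to$, and $t{\Downarrow}$ (may-termination) if $t\Rightarrow^{*}v$ for some $v$ of the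 form $\mathsf{lam}\,x.t'$, $\mathsf{inl}(t')$, $\mathsf{inr}(t')$, $\mathsf{pair}(t',t'')$ or $\mathsf{fold}(t')$. **Relations.** A relation on $X\in\mathcal C$ is a subobject of $X\times X$, i.e. a family of relations $R_\tau(\Gamma)$ on $X_\tau(\Gamma)$ closed under renaming; $R$ is reflexive if it contains the identity relation. For a relation $R$ on $\Lambda$, $\overline\Sigma R$ is the image of $\Sigma R\to\Sigma\Lambda\times\Sigma\Lambda$, and $R$ is a *congruence* if $\iota_\star(\overline\Sigma R)\le R$, i.e. if it is compatible with all operations. Let $O_\tau(\Gamma)=\{(t,s)\mid t{\Downarrow}\text{ implies }s{\Downarrow}\}$. The *may-termination contextual preorder* $\lesssim_O$ is the greatest congruence on $\Lambda$ that is contained in $O$. **The generic logical relation.** Let $$B(X,Y)=\langle\!\langle X,Y\rangle\!\rangle\times\mathcal P_\star(Y+D(X,Y)),\qquad \langle\!\langle X,Y\rangle\!\rangle_\tau(\Gamma)=\mathbf{Set}^{\mathbb F/\mathsf{Ty}}\Bigl(\prod_{x\in|\Gamma|}X_{\Gamma(x)},Y_\tau\Bigr),$$ where $\mathcal P_\star$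 is the pointwise power set, $D_{\tau_1\Rightarrow\tau_2}(X,Y)=Y_{\tau_2}^{X_{\tau_1}}$ (exponential of presheaves), $D_{\tau_1\boxplus\tau_2}(X,Y)=Y_{\tau_1}+Y_{\tau_2}$, $D_{\tau_1\boxtimes\tau_2}(X,Y)=Y_{\tau_1}\times Y_{\tau_2}$ and $D_{\mu\alpha.\tau}(X,Y)=Y_{\tau[\mu\alpha.\tau/\alpha]}$. Let $\overline B(Q,R)=\overline{\langle\!\langle Q,R\rangle\!\rangle}\times\overline{\mathcal P}_\star(R+\overline D(Q,R))$ with the canonical liftings of $\langle\!\langle-,-\rangle\!\rangle$ and $D$ and the left-to-right Egli–Milner lifting $\overline{\mathcal P}_\star$ (for all $a\in A$ there is a related $b\in B$). Let $\gamma_0(t)=(\vec u\mapsto t[\vec u])$. Let $\gamma(t)$ consist of all $t'$ with $t\to t'$ and, if $t$ is a value, its value behaviour: $e\mapsto s[e/x]$ for $t=\mathsf{lam}\,x.s$, and the component(s) of $t$ for $t=\mathsf{inl}(t'),\mathsf{inr}(t'),\mathsf{pair}(t',t''),\mathsf{fold}(t')$. Let $\widetilde\gamma(t)$ consist of all $t'$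 with $t\Rightarrow^{*}t'$ and all value behaviours of such $t'$. The relations $\square^\alpha$ on $\Lambda$ are defined by $\square^0=\top$, $\square^{\alpha+1}=\square^\alpha\wedge(\langle\gamma_0,\gamma\rangle\times\langle\gamma_0,\widetilde\gamma\rangle)^\star[\overline B(\square^\alpha,\square^\alpha)]$, and $\square^\alpha=\bigwedge_{\beta<\alpha}\square^\beta$ at limit ordinals. **The explicit logical relation.** Let $\mathcal L^0=\top$, $\mathcal L^{\alpha+1}=\mathcal L^\alpha\cap\mathcal S(\mathcal L^\alpha,\mathcal L^\alpha)\cap\mathcal E(\mathcal L^\alpha)\cap\mathcal V(\mathcal L^\alpha,\mathcal L^\alpha)$ and $\mathcal L^\alpha=\bigcap_{\beta<\alpha}\mathcal L^\beta$ at limit ordinals, as families of relations on the sets $\Lambda_\tau(\Gamma)$, where, for $t,s\in\Lambda_\tau(\Gamma)$: - $(t,s)\in\mathcal S(Q,R)$ iff $R_\tau(\Delta)(t[\vec u],s[\vec v])$ for all $\Delta$ and all substitutions $\vec u,\vec v$ from $\Gamma$ to $\Delta$ with $Q_{\Gamma(x)}(\Delta)(u_x,v_x)$ for all $x\in|\Gamma|$;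 - $(t,s)\in\mathcal E(R)$ iff for every $t\to t'$ there is $s\Rightarrow^{*}s'$ with $R_\tau(\Gamma)(t',s')$; - $(t,s)\in\mathcal V(Q,R)$ iff, at type $\tau_1\boxplus\tau_2$: if $t=\mathsf{inl}(t')$ then $s\Rightarrow^{*}\mathsf{inl}(s')$ for some $s'$ with $R(t',s')$, and likewise for $\mathsf{inr}$; at $\tau_1\boxtimes\tau_2$: if $t=\mathsf{pair}(t_1,t_2)$ then $s\Rightarrow^{*}\mathsf{pair}(s_1,s_2)$ for some $s_1,s_2$ with $R(t_i,s_i)$; at $\mu\alpha.\tau$: if $t=\mathsf{fold}(t')$ then $s\Rightarrow^{*}\mathsf{fold}(s')$ for some $s'$ with $R(t',s')$; at $\tau_1\Rightarrow\tau_2$: for all $e,e'$ with $Q_{\tau_1}(\Gamma)(e,e')$, if $t=\mathsf{lam}\,x.t'$ then $s\Rightarrow^{*}\mathsf{lam}\,x.s'$ for some $s'$ with $R_{\tau_2}(\Gamma)(t'[e/x],s'[e'/x])$. **Theorem.** Let $2^\omega$ denote the initial ordinal of the cardinality of the continuum. 1. For every ordinal $\alpha\le 2^\omega$, the relation $\square^\alpha$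 on $\Lambda$ is a reflexive congruence. 2. The contextual preorder $\lesssim_O$ exists, and $\square^{2^\omega}$ is sound for it: $\square^{2^\omega}\le{\lesssim_O}$. 3. The family $\mathcal L^{2^\omega}$ is closed under renaming, so it is a relation on $\Lambda$; it is a reflexive congruence, and it is sound for the contextual preorder: $\mathcal L^{2^\omega}\le{\lesssim_O}$. -/

import Mathlib

open CategoryTheory

namespace FPC

/-! ### Types -/

/-- Type expressions with free type variables among `0, …, n - 1`, in de Bruijn notation
(hence modulo `α`-equivalence); `mu` binds the variable `0` of its body. -/
inductive TyExp : ℕ → Type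
  | var {n : ℕ} (i : Fin n) : TyExp n
  | sum {n : ℕ} (a b : TyExp n) : TyExp n
  | prod {n : ℕ} (a b : TyExp n) : TyExp n
  | arr {n : ℕ} (a b : TyExp n) : TyExp n
  | mu {n : ℕ} (a : TyExp (n + 1)) : TyExp n

def TyExp.rename : {n m : ℕ} → TyExp n → (Fin n → Fin m) → TyExp m
  | _, _, .var i, r => .var (r i)
  | _, _, .sum a b, r => .sum (a.rename r) (b.rename r)
  | _, _, .prod a b, r => .prod (a.rename r) (b.rename r)
  | _, _, .arr a b, r => .arr (a.rename r) (b.rename r)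
  | _, _, .mu a, r => .mu (a.rename (Fin.cases 0 (fun i => (r i).succ)))

/-- Capture-avoiding simultaneous substitution of types for type variables. -/
def TyExp.subst : {n m : ℕ} → TyExp n → (Fin n → TyExp m) → TyExp m
  | _, _, .var i, s => s i
  | _, _, .sum a b, s => .sum (a.subst s) (b.subst s)
  | _, _, .prod a b, s => .prod (a.subst s) (b.subst s)
  | _, _, .arr a b, s => .arr (a.subst s) (b.subst s)
  | _, _, .mu a, s => .mu (a.subst (Fin.cases (.var 0) (fun i => (s i).rename Fin.succ)))

/-- The set `Ty` of closed types. -/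
abbrev Ty : Type := TyExp 0

/-- `unroll τ = τ[μα.τ/α]`, for a type `τ` with one free variable `α`. -/
def unroll (τ : TyExp 1) : Ty := τ.subst (fun _ => .mu τ)

/-! ### The category `𝔽/Ty` of contexts -/

/-- An object of `𝔽/Ty`: a finite cardinal `len` with a map to `Ty`. -/
structure Ctx where
  len : ℕ
  ty : Fin len → Ty

/-- Morphisms of `𝔽/Ty` are the type-respecting renamings. -/
instance : Category Ctx where
  Hom Γ Δ := {r : Fin Γ.len → Fin Δ.len // ∀ x, Δ.ty (r x) = Γ.ty x}
  id Γ := ⟨fun x => x, fun _ => rfl⟩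
  comp r s := ⟨fun x => s.1 (r.1 x), fun x => (s.2 (r.1 x)).trans (r.2 x)⟩

/-- Context extension `Γ + τ̌`; the new variable has number `0`, the old ones are shifted
by one. -/
def Ctx.ext (Γ : Ctx) (τ : Ty) : Ctx := ⟨Γ.len + 1, Fin.cases τ Γ.ty⟩

/-- The coproduct injection `Γ ⟶ Γ + τ̌`. -/
def wk (Γ : Ctx) (τ : Ty) : Γ ⟶ Γ.ext τ := ⟨Fin.succ, fun _ => rfl⟩

/-- The action `r + τ̌` of context extension on renamings. -/
def extMap {Γ Δ : Ctx} (r : Γ ⟶ Δ) (τ : Ty) : Γ.ext τ ⟶ Δ.ext τ :=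
  ⟨Fin.cases (0 : Fin (Δ.len + 1)) (fun x => (r.1 x).succ), fun x => by
    refine Fin.cases ?_ (fun x => ?_) x
    · rfl
    · exact r.2 x⟩

/-- The set `V_τ(Γ)` of variables of type `τ` in context `Γ`. -/
def Var (Γ : Ctx) (τ : Ty) : Type := {x : Fin Γ.len // Γ.ty x = τ}

def Var.rename {Γ Δ : Ctx} {τ : Ty} (x : Var Γ τ) (r : Γ ⟶ Δ) : Var Δ τ :=
  ⟨r.1 x.1, (r.2 x.1).trans x.2⟩

/-! ### Terms, renaming, substitution -/

/-- `Tm Γ τ` is the set of terms `t` (modulo `α`-equivalence) with `Γ ⊢ t : τ`. -/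
inductive Tm : Ctx → Ty → Type
  | var {Γ : Ctx} {τ : Ty} (x : Var Γ τ) : Tm Γ τ
  | choice {Γ : Ctx} {τ : Ty} (t s : Tm Γ τ) : Tm Γ τ
  | app {Γ : Ctx} {a b : Ty} (t : Tm Γ (.arr a b)) (s : Tm Γ a) : Tm Γ b
  | lam {Γ : Ctx} {a b : Ty} (t : Tm (Γ.ext a) b) : Tm Γ (.arr a b)
  | inl {Γ : Ctx} {a b : Ty} (t : Tm Γ a) : Tm Γ (.sum a b)
  | inr {Γ : Ctx} {a b : Ty} (t : Tm Γ b) : Tm Γ (.sum a b)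
  | cond {Γ : Ctx} {a b c : Ty} (t : Tm Γ (.sum a b)) (s : Tm Γ (.arr a c))
      (r : Tm Γ (.arr b c)) : Tm Γ c
  | pair {Γ : Ctx} {a b : Ty} (t : Tm Γ a) (s : Tm Γ b) : Tm Γ (.prod a b)
  | fst {Γ : Ctx} {a b : Ty} (t : Tm Γ (.prod a b)) : Tm Γ a
  | snd {Γ : Ctx} {a b : Ty} (t : Tm Γ (.prod a b)) : Tm Γ b
  | fold {Γ : Ctx} {τ : TyExp 1} (t : Tm Γ (unroll τ)) : Tm Γ (.mu τ)
  | unfold {Γ : Ctx} {σ : Ty} (τ : TyExp 1) (h : unroll τ = σ) (t : Tm Γ (.mu τ)) : Tm Γ σ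

def Tm.rename : {Γ Δ : Ctx} → {τ : Ty} → Tm Γ τ → (Γ ⟶ Δ) → Tm Δ τ
  | _, _, _, .var x, r => .var (x.rename r)
  | _, _, _, .choice t s, r => .choice (t.rename r) (s.rename r)
  | _, _, _, .app t s, r => .app (t.rename r) (s.rename r)
  | _, _, _, .lam t, r => .lam (t.rename (extMap r _))
  | _, _, _, .inl t, r => .inl (t.rename r)
  | _, _, _, .inr t, r => .inr (t.rename r)
  | _, _, _, .cond t s q, r => .cond (t.rename r) (s.rename r) (q.rename r)
  | _, _, _, .pair t s, r => .pair (t.rename r) (s.rename r)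
  | _, _, _, .fst t, r => .fst (t.rename r)
  | _, _, _, .snd t, r => .snd (t.rename r)
  | _, _, _, .fold t, r => .fold (t.rename r)
  | _, _, _, .unfold τ h t, r => .unfold τ h (t.rename r)

/-- An element of `∏_{x ∈ |Γ|} Λ_{Γ(x)}(Δ)`, i.e. a simultaneous substitution. -/
abbrev Sub (Γ Δ : Ctx) : Type := ∀ x : Fin Γ.len, Tm Δ (Γ.ty x)

/-- Extend a substitution by a term for the new variable. -/
def Sub.snoc {Γ Δ : Ctx} {a : Ty} (u : Sub Γ Δ) (e : Tm Δ a) : Sub (Γ.ext a) Δ :=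
  fun x => Fin.cases (motive := fun x => Tm Δ ((Γ.ext a).ty x)) e u x

/-- A renaming, as a substitution of variables for variables. -/
def Sub.ofRen {Γ Δ : Ctx} (r : Γ ⟶ Δ) : Sub Γ Δ := fun x => .var ⟨r.1 x, r.2 x⟩

/-- Push a substitution under a binder. -/
def Sub.lift {Γ Δ : Ctx} (u : Sub Γ Δ) (a : Ty) : Sub (Γ.ext a) (Δ.ext a) :=
  Sub.snoc (fun x => (u x).rename (wk Δ a)) (.var ⟨(0 : Fin (Δ.len + 1)), rfl⟩)

/-- Simultaneous capture-avoiding substitution `t[u]`. -/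
def Tm.subst : {Γ Δ : Ctx} → {τ : Ty} → Tm Γ τ → Sub Γ Δ → Tm Δ τ
  | _, _, _, .var x, u => x.2 ▸ u x.1
  | _, _, _, .choice t s, u => .choice (t.subst u) (s.subst u)
  | _, _, _, .app t s, u => .app (t.subst u) (s.subst u)
  | _, _, _, .lam t, u => .lam (t.subst (u.lift _))
  | _, _, _, .inl t, u => .inl (t.subst u)
  | _, _, _, .inr t, u => .inr (t.subst u)
  | _, _, _, .cond t s q, u => .cond (t.subst u) (s.subst u) (q.subst u)
  | _, _, _, .pair t s, u => .pair (t.subst u) (s.subst u)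
  | _, _, _, .fst t, u => .fst (t.subst u)
  | _, _, _, .snd t, u => .snd (t.subst u)
  | _, _, _, .fold t, u => .fold (t.subst u)
  | _, _, _, .unfold τ h t, u => .unfold τ h (t.subst u)

/-- `t[e/x]`, where `x` is the last variable added to the context. -/
def Tm.inst {Γ : Ctx} {a b : Ty} (t : Tm (Γ.ext a) b) (e : Tm Γ a) : Tm Γ b :=
  t.subst (Sub.snoc (Sub.ofRen (𝟙 Γ)) e)

theorem extMap_id (Γ : Ctx) (a : Ty) : extMap (𝟙 Γ) a = 𝟙 (Γ.ext a) := by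
  apply Subtype.ext; funext x
  refine Fin.cases ?_ (fun x => ?_) x <;> rfl

theorem extMap_comp {Γ Δ E : Ctx} (r : Γ ⟶ Δ) (s : Δ ⟶ E) (a : Ty) :
    extMap (r ≫ s) a = extMap r a ≫ extMap s a := by
  apply Subtype.ext; funext x
  refine Fin.cases ?_ (fun x => ?_) x <;> rfl

theorem wk_extMap {Γ Δ : Ctx} (r : Γ ⟶ Δ) (a : Ty) :
    wk Γ a ≫ extMap r a = r ≫ wk Δ a := rfl

theorem Tm.rename_id {Γ : Ctx} {τ : Ty} (t : Tm Γ τ) : t.rename (𝟙 Γ) = t := by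
  induction t <;> simp_all [Tm.rename, extMap_id]
  rfl

theorem Tm.rename_comp {Γ Δ E : Ctx} {τ : Ty} (t : Tm Γ τ) (r : Γ ⟶ Δ) (s : Δ ⟶ E) :
    t.rename (r ≫ s) = (t.rename r).rename s := by
  induction t generalizing Δ E <;> simp_all [Tm.rename, extMap_comp]
  rfl

theorem Tm.rename_cast {Γ Δ : Ctx} {σ τ : Ty} (h : σ = τ) (t : Tm Γ σ) (r : Γ ⟶ Δ) :
    (h ▸ t : Tm Γ τ).rename r = h ▸ t.rename r := by
  subst h; rfl

theorem Sub.lift_rename {Γ Δ E : Ctx} (u : Sub Γ Δ) (r : Δ ⟶ E) (a : Ty) :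
    (fun x => (u.lift a x).rename (extMap r a)) = Sub.lift (fun x => (u x).rename r) a := by
  funext x
  refine Fin.cases ?_ (fun x => ?_) x
  · rfl
  · change ((u x).rename (wk Δ a)).rename (extMap r a) = ((u x).rename r).rename (wk E a)
    rw [← Tm.rename_comp, ← Tm.rename_comp, wk_extMap]

/-- Renaming after substituting. -/
theorem Tm.subst_rename {Γ Δ E : Ctx} {τ : Ty} (t : Tm Γ τ) (u : Sub Γ Δ) (r : Δ ⟶ E) :
    (t.subst u).rename r = t.subst (fun x => (u x).rename r) := by
  induction t generalizing Δ E <;>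
    simp_all [Tm.rename, Tm.subst, Tm.rename_cast, Sub.lift_rename]

/-- Precomposition of a substitution with a renaming. -/
def Sub.reindex {Γ Δ E : Ctx} (r : Γ ⟶ Δ) (u : Sub Δ E) : Sub Γ E :=
  fun x => r.2 x ▸ u (r.1 x)

theorem Sub.lift_reindex {Γ Δ E : Ctx} (r : Γ ⟶ Δ) (u : Sub Δ E) (a : Ty) :
    (u.lift a).reindex (extMap r a) = (u.reindex r).lift a := by
  funext x
  refine Fin.cases ?_ (fun x => ?_) x
  · rfl
  · exact (Tm.rename_cast (r.2 x) _ _).symm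

/-- Substituting after renaming. -/
theorem Tm.rename_subst {Γ Δ E : Ctx} {τ : Ty} (t : Tm Γ τ) (r : Γ ⟶ Δ) (u : Sub Δ E) :
    (t.rename r).subst u = t.subst (u.reindex r) := by
  induction t generalizing Δ E with
  | var x => obtain ⟨x, rfl⟩ := x; rfl
  | lam t ih => simp [Tm.rename, Tm.subst, ih, Sub.lift_reindex]
  | _ => simp_all [Tm.rename, Tm.subst]

theorem Sub.snoc_rename {Γ Δ E : Ctx} {a : Ty} (u : Sub Γ Δ) (e : Tm Δ a) (r : Δ ⟶ E) :
    (fun x => (u.snoc e x).rename r) = Sub.snoc (fun x => (u x).rename r) (e.rename r) := by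
  funext x
  refine Fin.cases ?_ (fun x => ?_) x <;> rfl

theorem Sub.snoc_reindex {Γ Δ E : Ctx} {a : Ty} (r : Γ ⟶ Δ) (u : Sub Δ E) (e : Tm E a) :
    (u.snoc e).reindex (extMap r a) = (u.reindex r).snoc e := by
  funext x
  refine Fin.cases ?_ (fun x => ?_) x <;> rfl

theorem Sub.ofRen_reindex {Γ Δ E : Ctx} (r : Γ ⟶ Δ) (s : Δ ⟶ E) :
    (Sub.ofRen s).reindex r = Sub.ofRen (r ≫ s) := by
  funext x
  have : ∀ {σ τ : Ty} (h : σ = τ) (y : Var E σ),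
      (h ▸ Tm.var y : Tm E τ) = .var ⟨y.1, y.2.trans h⟩ := by
    intro σ τ h y; subst h; rfl
  exact this (r.2 x) _

theorem Tm.inst_rename {Γ Δ : Ctx} {a b : Ty} (t : Tm (Γ.ext a) b) (e : Tm Γ a) (r : Γ ⟶ Δ) :
    (t.inst e).rename r = (t.rename (extMap r a)).inst (e.rename r) := by
  unfold Tm.inst
  rw [Tm.subst_rename, Tm.rename_subst, Sub.snoc_rename, Sub.snoc_reindex, Sub.ofRen_reindex]
  rfl

/-! ### Operational semantics -/

/-- One-step call-by-name reduction `t → t'`. -/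
inductive Step : {Γ : Ctx} → {τ : Ty} → Tm Γ τ → Tm Γ τ → Prop
  | app {Γ : Ctx} {a b : Ty} {t t' : Tm Γ (.arr a b)} {s : Tm Γ a} :
      Step t t' → Step (.app t s) (.app t' s)
  | beta {Γ : Ctx} {a b : Ty} {t : Tm (Γ.ext a) b} {s : Tm Γ a} :
      Step (.app (.lam t) s) (t.inst s)
  | unfold {Γ : Ctx} {σ : Ty} {τ : TyExp 1} {h : unroll τ = σ} {t t' : Tm Γ (.mu τ)} :
      Step t t' → Step (.unfold τ h t) (.unfold τ h t')
  | unfoldFold {Γ : Ctx} {σ : Ty} {τ : TyExp 1} {h : unroll τ = σ} {t : Tm Γ (unroll τ)} :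
      Step (.unfold τ h (.fold t)) (h ▸ t)
  | fst {Γ : Ctx} {a b : Ty} {t t' : Tm Γ (.prod a b)} : Step t t' → Step (.fst t) (.fst t')
  | snd {Γ : Ctx} {a b : Ty} {t t' : Tm Γ (.prod a b)} : Step t t' → Step (.snd t) (.snd t')
  | fstPair {Γ : Ctx} {a b : Ty} {t : Tm Γ a} {s : Tm Γ b} : Step (.fst (.pair t s)) t
  | sndPair {Γ : Ctx} {a b : Ty} {t : Tm Γ a} {s : Tm Γ b} : Step (.snd (.pair t s)) s
  | choiceLeft {Γ : Ctx} {τ : Ty} {t s : Tm Γ τ} : Step (.choice t s) t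
  | choiceRight {Γ : Ctx} {τ : Ty} {t s : Tm Γ τ} : Step (.choice t s) s
  | cond {Γ : Ctx} {a b c : Ty} {t t' : Tm Γ (.sum a b)} {s : Tm Γ (.arr a c)}
      {r : Tm Γ (.arr b c)} : Step t t' → Step (.cond t s r) (.cond t' s r)
  | condInl {Γ : Ctx} {a b c : Ty} {t : Tm Γ a} {s : Tm Γ (.arr a c)} {r : Tm Γ (.arr b c)} :
      Step (.cond (.inl t) s r) (.app s t)
  | condInr {Γ : Ctx} {a b c : Ty} {t : Tm Γ b} {s : Tm Γ (.arr a c)} {r : Tm Γ (.arr b c)} :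
      Step (.cond (.inr t) s r) (.app r t)

/-- `t ⟹ t'`, the reflexive transitive hull of reduction. -/
def Steps {Γ : Ctx} {τ : Ty} : Tm Γ τ → Tm Γ τ → Prop := Relation.ReflTransGen Step

/-- Values: the terms that have a labelled transition. -/
inductive IsValue : {Γ : Ctx} → {τ : Ty} → Tm Γ τ → Prop
  | lam {Γ : Ctx} {a b : Ty} (t : Tm (Γ.ext a) b) : IsValue (.lam t)
  | inl {Γ : Ctx} {a b : Ty} (t : Tm Γ a) : IsValue (.inl (b := b) t)
  | inr {Γ : Ctx} {a b : Ty} (t : Tm Γ b) : IsValue (.inr (a := a) t)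
  | pair {Γ : Ctx} {a b : Ty} (t : Tm Γ a) (s : Tm Γ b) : IsValue (.pair t s)
  | fold {Γ : Ctx} {τ : TyExp 1} (t : Tm Γ (unroll τ)) : IsValue (.fold t)

/-- May-termination `t⇓`. -/
def Terminates {Γ : Ctx} {τ : Ty} (t : Tm Γ τ) : Prop := ∃ v, Steps t v ∧ IsValue v

theorem Step.rename {Γ Δ : Ctx} {τ : Ty} {t t' : Tm Γ τ} (h : Step t t') (r : Γ ⟶ Δ) :
    Step (t.rename r) (t'.rename r) := by
  induction h with
  | beta => rw [Tm.inst_rename]; exact .beta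
  | unfoldFold => rw [Tm.rename_cast]; exact .unfoldFold
  | app _ ih => exact .app ih
  | unfold _ ih => exact .unfold ih
  | fst _ ih => exact .fst ih
  | snd _ ih => exact .snd ih
  | cond _ ih => exact .cond ih
  | fstPair => exact .fstPair
  | sndPair => exact .sndPair
  | choiceLeft => exact .choiceLeft
  | choiceRight => exact .choiceRight
  | condInl => exact .condInl
  | condInr => exact .condInr

theorem Step.of_rename {Γ Δ : Ctx} {τ : Ty} (t : Tm Γ τ) (r : Γ ⟶ Δ) (p : Tm Δ τ)
    (h : Step (t.rename r) p) : ∃ t', Step t t' ∧ t'.rename r = p := by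
  induction t with
  | var x => cases h
  | lam t => cases h
  | inl t => cases h
  | inr t => cases h
  | pair t s => cases h
  | fold t => cases h
  | choice t s =>
    cases h with
    | choiceLeft => exact ⟨_, .choiceLeft, rfl⟩
    | choiceRight => exact ⟨_, .choiceRight, rfl⟩
  | app t s iht _ =>
    change Step (Tm.app (t.rename r) (s.rename r)) p at h
    generalize hq : t.rename r = q at h
    cases h with
    | app hs =>
      subst hq
      obtain ⟨t', h1, rfl⟩ := iht r _ hs
      exact ⟨_, .app h1, rfl⟩
    | beta =>
      cases t <;> simp only [Tm.rename, reduceCtorEq, Tm.lam.injEq] at hq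
      subst hq
      exact ⟨_, .beta, Tm.inst_rename _ _ _⟩
  | fst t ih =>
    change Step (Tm.fst (t.rename r)) p at h
    generalize hq : t.rename r = q at h
    cases h with
    | fst hs =>
      subst hq
      obtain ⟨t', h1, rfl⟩ := ih r _ hs
      exact ⟨_, .fst h1, rfl⟩
    | fstPair =>
      cases t <;> simp only [Tm.rename, reduceCtorEq, Tm.pair.injEq] at hq
      obtain ⟨rfl, rfl⟩ := hq
      exact ⟨_, .fstPair, rfl⟩
  | snd t ih =>
    change Step (Tm.snd (t.rename r)) p at h
    generalize hq : t.rename r = q at h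
    cases h with
    | snd hs =>
      subst hq
      obtain ⟨t', h1, rfl⟩ := ih r _ hs
      exact ⟨_, .snd h1, rfl⟩
    | sndPair =>
      cases t <;> simp only [Tm.rename, reduceCtorEq, Tm.pair.injEq] at hq
      obtain ⟨rfl, rfl⟩ := hq
      exact ⟨_, .sndPair, rfl⟩
  | unfold τ hτ t ih =>
    change Step (Tm.unfold τ hτ (t.rename r)) p at h
    generalize hq : t.rename r = q at h
    cases h with
    | unfold hs =>
      subst hq
      obtain ⟨t', h1, rfl⟩ := ih r _ hs
      exact ⟨_, .unfold h1, rfl⟩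
    | unfoldFold =>
      cases t <;> simp only [Tm.rename, reduceCtorEq, Tm.fold.injEq] at hq
      subst hq
      exact ⟨_, .unfoldFold, Tm.rename_cast _ _ _⟩
  | cond t s q iht _ _ =>
    change Step (Tm.cond (t.rename r) (s.rename r) (q.rename r)) p at h
    generalize hq : t.rename r = w at h
    cases h with
    | cond hs =>
      subst hq
      obtain ⟨t', h1, rfl⟩ := iht r _ hs
      exact ⟨_, .cond h1, rfl⟩
    | condInl =>
      cases t <;> simp only [Tm.rename, reduceCtorEq, Tm.inl.injEq] at hq
      subst hq
      exact ⟨_, .condInl, rfl⟩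
    | condInr =>
      cases t <;> simp only [Tm.rename, reduceCtorEq, Tm.inr.injEq] at hq
      subst hq
      exact ⟨_, .condInr, rfl⟩

theorem Steps.rename {Γ Δ : Ctx} {τ : Ty} {t t' : Tm Γ τ} (h : Steps t t') (r : Γ ⟶ Δ) :
    Steps (t.rename r) (t'.rename r) := by
  unfold Steps at h
  induction h with
  | refl => exact .refl
  | tail _ h2 ih => exact .tail ih (h2.rename r)

theorem Steps.of_rename {Γ Δ : Ctx} {τ : Ty} (t : Tm Γ τ) (r : Γ ⟶ Δ) (p : Tm Δ τ)
    (h : Steps (t.rename r) p) : ∃ t', Steps t t' ∧ t'.rename r = p := by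
  unfold Steps at h
  induction h with
  | refl => exact ⟨t, .refl, rfl⟩
  | tail _ h2 ih =>
    obtain ⟨q, h3, rfl⟩ := ih
    obtain ⟨q', h4, h5⟩ := Step.of_rename q r _ h2
    exact ⟨q', .tail h3 h4, h5⟩

theorem IsValue.rename {Γ Δ : Ctx} {τ : Ty} {t : Tm Γ τ} (h : IsValue t) (r : Γ ⟶ Δ) :
    IsValue (t.rename r) := by
  cases h <;> constructor

theorem IsValue.of_rename {Γ Δ : Ctx} {τ : Ty} (t : Tm Γ τ) (r : Γ ⟶ Δ)
    (h : IsValue (t.rename r)) : IsValue t := by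
  cases t <;> first | constructor | (simp only [Tm.rename] at h; cases h)

theorem terminates_rename {Γ Δ : Ctx} {τ : Ty} (t : Tm Γ τ) (r : Γ ⟶ Δ) :
    Terminates (t.rename r) ↔ Terminates t := by
  constructor
  · rintro ⟨v, h1, h2⟩
    obtain ⟨v, h3, rfl⟩ := Steps.of_rename t r v h1
    exact ⟨v, h3, h2.of_rename⟩
  · rintro ⟨v, h1, h2⟩
    exact ⟨_, h1.rename r, h2.rename r⟩

/-! ### Presheaves and relations -/

/-- The base category `(Set^{𝔽/Ty})^Ty`. -/
abbrev Psh : Type 1 := Ty → (Ctx ⥤ Type)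

/-- A relation on `X`, i.e. a subobject of `X × X`, given in each sort by a subfunctor. -/
abbrev Rel (X : Psh) : Type := ∀ τ : Ty, Subfunctor (FunctorToTypes.prod (X τ) (X τ))

/-- The object `R` of a relation `R ↣ X × X`, with its two projections. -/
def Rel.carrier {X : Psh} (R : Rel X) : Psh := fun τ => (R τ).toFunctor

def Rel.left {X : Psh} (R : Rel X) : R.carrier ⟶ X :=
  fun τ => (R τ).ι ≫ FunctorToTypes.prod.fst

def Rel.right {X : Psh} (R : Rel X) : R.carrier ⟶ X :=
  fun τ => (R τ).ι ≫ FunctorToTypes.prod.snd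

/-- The morphism `f × g : X × X ⟶ Y × Y` in sort `τ`. -/
def prodMap {X Y : Psh} (f g : X ⟶ Y) (τ : Ty) :
    FunctorToTypes.prod (X τ) (X τ) ⟶ FunctorToTypes.prod (Y τ) (Y τ) :=
  FunctorToTypes.prod.lift (FunctorToTypes.prod.fst ≫ f τ) (FunctorToTypes.prod.snd ≫ g τ)

/-- The direct image `f⋆[R]` of a relation under `f × f`. -/
def Rel.directImage {X Y : Psh} (f : X ⟶ Y) (R : Rel X) : Rel Y :=
  fun τ => (R τ).image (prodMap f f τ)

/-- The preimage of a relation under `f × g`. -/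
def Rel.inverseImage {X Y : Psh} (f g : X ⟶ Y) (S : Rel Y) : Rel X :=
  fun τ => (S τ).preimage (prodMap f g τ)

/-- The identity relation. -/
def Rel.diag (X : Psh) : Rel X := fun τ => Subfunctor.range
  (FunctorToTypes.prod.lift (𝟙 (X τ)) (𝟙 (X τ)))

def Rel.Reflexive {X : Psh} (R : Rel X) : Prop := Rel.diag X ≤ R

/-- The canonical relation lifting of an endofunctor `F`: the image of
`⟨F l, F r⟩ : F R ⟶ F X × F X`. -/
def canonicalLift (F : Psh ⥤ Psh) {X : Psh} (R : Rel X) : Rel (F.obj X) :=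
  fun τ => Subfunctor.range
    (FunctorToTypes.prod.lift (F.map R.left τ) (F.map R.right τ))

/-- `R` is a congruence on the `F`-algebra `a : F A ⟶ A`. -/
def IsCongruence (F : Psh ⥤ Psh) {A : Psh} (a : F.obj A ⟶ A) (R : Rel A) : Prop :=
  Rel.directImage a (canonicalLift F R) ≤ R

/-! ### The binding signature and the algebra of terms -/

/-- The value `(Σ X)_τ(Γ)` of the signature functor; there is one summand per operation. -/
inductive SigObj (X : Psh) : Ctx → Ty → Type
  | var {Γ : Ctx} {τ : Ty} (x : Var Γ τ) : SigObj X Γ τ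
  | choice {Γ : Ctx} {τ : Ty} (t s : (X τ).obj Γ) : SigObj X Γ τ
  | app {Γ : Ctx} {a b : Ty} (t : (X (.arr a b)).obj Γ) (s : (X a).obj Γ) : SigObj X Γ b
  | lam {Γ : Ctx} {a b : Ty} (t : (X b).obj (Γ.ext a)) : SigObj X Γ (.arr a b)
  | inl {Γ : Ctx} {a b : Ty} (t : (X a).obj Γ) : SigObj X Γ (.sum a b)
  | inr {Γ : Ctx} {a b : Ty} (t : (X b).obj Γ) : SigObj X Γ (.sum a b)
  | cond {Γ : Ctx} {a b c : Ty} (t : (X (.sum a b)).obj Γ) (s : (X (.arr a c)).obj Γ)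
      (r : (X (.arr b c)).obj Γ) : SigObj X Γ c
  | pair {Γ : Ctx} {a b : Ty} (t : (X a).obj Γ) (s : (X b).obj Γ) : SigObj X Γ (.prod a b)
  | fst {Γ : Ctx} {a b : Ty} (t : (X (.prod a b)).obj Γ) : SigObj X Γ a
  | snd {Γ : Ctx} {a b : Ty} (t : (X (.prod a b)).obj Γ) : SigObj X Γ b
  | fold {Γ : Ctx} {τ : TyExp 1} (t : (X (unroll τ)).obj Γ) : SigObj X Γ (.mu τ)
  | unfold {Γ : Ctx} {σ : Ty} (τ : TyExp 1) (h : unroll τ = σ) (t : (X (.mu τ)).obj Γ) :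
      SigObj X Γ σ

/-- The action of the presheaf `Σ X` on renamings. -/
def SigObj.rename {X : Psh} {Γ Δ : Ctx} (r : Γ ⟶ Δ) : {τ : Ty} → SigObj X Γ τ → SigObj X Δ τ
  | _, .var x => .var (x.rename r)
  | _, .choice t s => .choice ((X _).map r t) ((X _).map r s)
  | _, .app t s => .app ((X _).map r t) ((X _).map r s)
  | _, .lam t => .lam ((X _).map (extMap r _) t)
  | _, .inl t => .inl ((X _).map r t)
  | _, .inr t => .inr ((X _).map r t)
  | _, .cond t s q => .cond ((X _).map r t) ((X _).map r s) ((X _).map r q)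
  | _, .pair t s => .pair ((X _).map r t) ((X _).map r s)
  | _, .fst t => .fst ((X _).map r t)
  | _, .snd t => .snd ((X _).map r t)
  | _, .fold t => .fold ((X _).map r t)
  | _, .unfold τ h t => .unfold τ h ((X _).map r t)

/-- The action of `Σ` on morphisms. -/
def SigObj.map {X Y : Psh} (f : X ⟶ Y) {Γ : Ctx} : {τ : Ty} → SigObj X Γ τ → SigObj Y Γ τ
  | _, .var x => .var x
  | _, .choice t s => .choice ((f _).app Γ t) ((f _).app Γ s)
  | _, .app t s => .app ((f _).app Γ t) ((f _).app Γ s)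
  | _, .lam t => .lam ((f _).app _ t)
  | _, .inl t => .inl ((f _).app Γ t)
  | _, .inr t => .inr ((f _).app Γ t)
  | _, .cond t s q => .cond ((f _).app Γ t) ((f _).app Γ s) ((f _).app Γ q)
  | _, .pair t s => .pair ((f _).app Γ t) ((f _).app Γ s)
  | _, .fst t => .fst ((f _).app Γ t)
  | _, .snd t => .snd ((f _).app Γ t)
  | _, .fold t => .fold ((f _).app Γ t)
  | _, .unfold τ h t => .unfold τ h ((f _).app Γ t)

/-- The syntax endofunctor `Σ` of the binding signature of FPC. -/
def Sig : Psh ⥤ Psh where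
  obj X := fun τ =>
    { obj := fun Γ => SigObj X Γ τ
      map := fun r => ↾(SigObj.rename r)
      map_id := fun Γ => by
        ext t
        cases t <;> simp [SigObj.rename, extMap_id]
        rfl
      map_comp := fun r s => by
        ext t
        cases t <;> simp [SigObj.rename, extMap_comp]
        rfl }
  map f := fun τ =>
    { app := fun Γ => ↾(SigObj.map f)
      naturality := fun Γ Δ r => by
        ext t
        cases t <;> simp [SigObj.rename, SigObj.map, NatTrans.naturality_apply] }
  map_id X := by
    funext τ; ext Γ t
    cases t <;> rfl
  map_comp f g := by
    funext τ; ext Γ t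
    cases t <;> rfl

/-- The presheaf `Λ` of terms. -/
def Lam : Psh := fun τ =>
  { obj := fun Γ => Tm Γ τ
    map := fun r => ↾(fun t => Tm.rename t r)
    map_id := fun Γ => by ext t; exact t.rename_id
    map_comp := fun r s => by ext t; exact t.rename_comp r s }

def SigObj.toTm {Γ : Ctx} : {τ : Ty} → SigObj Lam Γ τ → Tm Γ τ
  | _, .var x => .var x
  | _, .choice t s => .choice t s
  | _, .app t s => .app t s
  | _, .lam t => .lam t
  | _, .inl t => .inl t
  | _, .inr t => .inr t
  | _, .cond t s q => .cond t s q
  | _, .pair t s => .pair t s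
  | _, .fst t => .fst t
  | _, .snd t => .snd t
  | _, .fold t => .fold t
  | _, .unfold τ h t => .unfold τ h t

/-- The structure `ι : Σ Λ ⟶ Λ` of the term algebra. -/
def iota : Sig.obj Lam ⟶ Lam := fun τ =>
  { app := fun Γ => ↾(SigObj.toTm)
    naturality := fun Γ Δ r => by
      ext t
      cases t <;> rfl }

/-! ### The behaviour bifunctor and its relation lifting -/

/-- The presheaf `Δ ↦ ∏_{x ∈ |Γ|} X_{Γ(x)}(Δ)`. -/
def ctxProd (X : Psh) (Γ : Ctx) : Ctx ⥤ Type where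
  obj Δ := ∀ x : Fin Γ.len, (X (Γ.ty x)).obj Δ
  map r := ↾(fun u x => (X (Γ.ty x)).map r (u x))
  map_id Δ := by ext u x; simp
  map_comp r s := by ext u x; simp

/-- Reindexing of tuples along a renaming. -/
def ctxProdMap (X : Psh) {Γ Δ : Ctx} (r : Γ ⟶ Δ) : ctxProd X Δ ⟶ ctxProd X Γ where
  app E := ↾(fun u x => (r.2 x ▸ u (r.1 x) : (X (Γ.ty x)).obj E))
  naturality E E' s := by
    have key : ∀ {σ τ : Ty} (h : σ = τ) (y : (X σ).obj E),
        (h ▸ (X σ).map s y : (X τ).obj E') = (X τ).map s (h ▸ y) := by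
      intro σ τ h y; subst h; rfl
    ext u; funext x
    exact key (r.2 x) _

/-- The presheaf `⟪X, Y⟫` of substitution structures,
`⟪X, Y⟫_τ(Γ) = Nat(∏_{x ∈ |Γ|} X_{Γ(x)}, Y_τ)`. -/
def substStr (X Y : Psh) : Psh := fun τ =>
  { obj := fun Γ => ctxProd X Γ ⟶ Y τ
    map := fun r => ↾(fun f => ctxProdMap X r ≫ f)
    map_id := fun Γ => by ext f; rfl
    map_comp := fun r s => by
      have key : ∀ {E : Ctx} {σ τ ρ : Ty} (h : σ = τ) (k : τ = ρ) (y : (X σ).obj E),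
          (h.trans k ▸ y : (X ρ).obj E) = k ▸ (h ▸ y : (X τ).obj E) := by
        intro E σ τ ρ h k y; subst h; subst k; rfl
      ext f E u
      change f.app E _ = f.app E _
      congr 1
      funext x
      exact key _ _ _ }

/-- The value `D_τ(X, Y)(Γ)` of the functor of value behaviours. The exponential of presheaves
is `Functor.functorHom`. -/
inductive DObj (X Y : Psh) (Γ : Ctx) : Ty → Type
  | fn {a b : Ty} (f : ((X a).functorHom (Y b)).obj Γ) : DObj X Y Γ (.arr a b)
  | inl {a b : Ty} (y : (Y a).obj Γ) : DObj X Y Γ (.sum a b)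
  | inr {a b : Ty} (y : (Y b).obj Γ) : DObj X Y Γ (.sum a b)
  | pair {a b : Ty} (y : (Y a).obj Γ) (z : (Y b).obj Γ) : DObj X Y Γ (.prod a b)
  | fold {τ : TyExp 1} (y : (Y (unroll τ)).obj Γ) : DObj X Y Γ (.mu τ)

def DObj.rename {X Y : Psh} {Γ Δ : Ctx} (r : Γ ⟶ Δ) : {τ : Ty} → DObj X Y Γ τ → DObj X Y Δ τ
  | _, .fn (a := a) (b := b) f => .fn (((X a).functorHom (Y b)).map r f)
  | _, .inl y => .inl ((Y _).map r y)
  | _, .inr y => .inr ((Y _).map r y)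
  | _, .pair y z => .pair ((Y _).map r y) ((Y _).map r z)
  | _, .fold y => .fold ((Y _).map r y)

/-- The presheaf `D(X, Y)`. -/
def DPsh (X Y : Psh) : Psh := fun τ =>
  { obj := fun Γ => DObj X Y Γ τ
    map := fun r => ↾(DObj.rename r)
    map_id := fun Γ => by
      ext d
      cases d <;> simp [DObj.rename, -Functor.homObjFunctor_map]
    map_comp := fun r s => by
      ext d
      cases d <;> simp [DObj.rename, -Functor.homObjFunctor_map] }

/-- The presheaf `Y + D(X, Y)`. -/
def YD (X Y : Psh) : Psh := fun τ =>
  { obj := fun Γ => (Y τ).obj Γ ⊕ (DPsh X Y τ).obj Γ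
    map := fun r => ↾(Sum.map ((Y τ).map r) ((DPsh X Y τ).map r))
    map_id := fun Γ => by ext d; cases d <;> simp
    map_comp := fun r s => by ext d; cases d <;> simp }

/-- The behaviour `B(X, Y) = ⟪X, Y⟫ × 𝒫(Y + D(X, Y))`, with the pointwise power set. -/
def Beh (X Y : Psh) : Psh := fun τ =>
  { obj := fun Γ => (substStr X Y τ).obj Γ × Set ((YD X Y τ).obj Γ)
    map := fun r => ↾(fun p => ((substStr X Y τ).map r p.1, (YD X Y τ).map r '' p.2))
    map_id := fun Γ => by ext p <;> simp
    map_comp := fun r s => by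
      ext p
      · simp
      · simp [Set.image_image] }

/-- The canonical relation lifting of `D`, applied to `Q` on `X` and `R` on `Y`. -/
inductive DRel {X Y : Psh} (Q : Rel X) (R : Rel Y) (Γ : Ctx) :
    {τ : Ty} → DObj X Y Γ τ → DObj X Y Γ τ → Prop
  | fn {a b : Ty} (f g : ((X a).functorHom (Y b)).obj Γ)
      (h : ∀ (Δ : Ctx) (r : Γ ⟶ Δ) (e e' : (X a).obj Δ), (e, e') ∈ (Q a).obj Δ →
        (f.app Δ r e, g.app Δ r e') ∈ (R b).obj Δ) : DRel Q R Γ (.fn f) (.fn g)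
  | inl {a b : Ty} (y y' : (Y a).obj Γ) (h : (y, y') ∈ (R a).obj Γ) :
      DRel Q R Γ (.inl (b := b) y) (.inl y')
  | inr {a b : Ty} (y y' : (Y b).obj Γ) (h : (y, y') ∈ (R b).obj Γ) :
      DRel Q R Γ (.inr (a := a) y) (.inr y')
  | pair {a b : Ty} (y y' : (Y a).obj Γ) (z z' : (Y b).obj Γ) (h : (y, y') ∈ (R a).obj Γ)
      (k : (z, z') ∈ (R b).obj Γ) : DRel Q R Γ (.pair y z) (.pair y' z')
  | fold {τ : TyExp 1} (y y' : (Y (unroll τ)).obj Γ) (h : (y, y') ∈ (R (unroll τ)).obj Γ) :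
      DRel Q R Γ (.fold y) (.fold y')

/-- The coproduct `R + D̄(Q, R)` of relations, on `Y + D(X, Y)`. -/
inductive YDRel {X Y : Psh} (Q : Rel X) (R : Rel Y) (Γ : Ctx) {τ : Ty} :
    (YD X Y τ).obj Γ → (YD X Y τ).obj Γ → Prop
  | inl (y y' : (Y τ).obj Γ) (h : (y, y') ∈ (R τ).obj Γ) : YDRel Q R Γ (.inl y) (.inl y')
  | inr (d d' : DObj X Y Γ τ) (h : DRel Q R Γ d d') : YDRel Q R Γ (.inr d) (.inr d')

theorem DRel.rename {X Y : Psh} {Q : Rel X} {R : Rel Y} {Γ Δ : Ctx} {τ : Ty}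
    {d d' : DObj X Y Γ τ} (h : DRel Q R Γ d d') (r : Γ ⟶ Δ) :
    DRel Q R Δ (d.rename r) (d'.rename r) := by
  cases h with
  | fn f g h => exact .fn _ _ (fun E s e e' he => h E (r ≫ s) e e' he)
  | inl y y' h => exact .inl _ _ ((R _).map r h)
  | inr y y' h => exact .inr _ _ ((R _).map r h)
  | pair y y' z z' h k => exact .pair _ _ _ _ ((R _).map r h) ((R _).map r k)
  | fold y y' h => exact .fold _ _ ((R _).map r h)

theorem YDRel.rename {X Y : Psh} {Q : Rel X} {R : Rel Y} {Γ Δ : Ctx} {τ : Ty}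
    {d d' : (YD X Y τ).obj Γ} (h : YDRel Q R Γ d d') (r : Γ ⟶ Δ) :
    YDRel Q R Δ ((YD X Y τ).map r d) ((YD X Y τ).map r d') := by
  cases h with
  | inl y y' h => exact .inl _ _ ((R _).map r h)
  | inr d d' h => exact .inr _ _ (h.rename r)

/-- The relation lifting `B̄(Q, R)` of `B`: the canonical lifting of `⟪-, -⟫` (related
substitutions are sent to related results), and the left-to-right Egli-Milner lifting of the
power set applied to `R + D̄(Q, R)`. -/
def behLift {X Y : Psh} (Q : Rel X) (R : Rel Y) : Rel (Beh X Y) := fun τ =>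
  { obj := fun Γ => {p |
      (∀ (Δ : Ctx) (u v : (ctxProd X Γ).obj Δ),
        (∀ x : Fin Γ.len, (u x, v x) ∈ (Q (Γ.ty x)).obj Δ) →
          (p.1.1.app Δ u, p.2.1.app Δ v) ∈ (R τ).obj Δ) ∧
      (∀ b ∈ p.1.2, ∃ b' ∈ p.2.2, YDRel Q R Γ b b')}
    map := by
      rintro Γ Δ r p ⟨h1, h2⟩
      refine ⟨fun E u v huv => h1 E _ _ (fun x => ?_), ?_⟩
      · have key : ∀ {σ τ : Ty} (h : σ = τ) (y z : (X σ).obj E), (y, z) ∈ (Q σ).obj E →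
            ((h ▸ y, h ▸ z) : (X τ).obj E × (X τ).obj E) ∈ (Q τ).obj E := by
          intro σ τ h y z hyz; subst h; exact hyz
        exact key (r.2 x) _ _ (huv (r.1 x))
      · rintro _ ⟨b, hb, rfl⟩
        obtain ⟨b', hb', hbb⟩ := h2 b hb
        exact ⟨_, ⟨b', hb', rfl⟩, hbb.rename r⟩ }

/-! ### The step-indexed logical relation of a pair of coalgebras -/

/-- The relations `□^α R` for coalgebras `c, c' : X ⟶ B(X, X)`, by transfinite recursion:
`□^0 R = R`, `□^(α+1) R = □^α R ∧ (c × c')⋆[B̄(□^α R, □^α R)]`, and meets at limits. -/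
noncomputable def henceforth {X : Psh} (c c' : X ⟶ Beh X X) (R : Rel X) (α : Ordinal.{0}) :
    Rel X :=
  Ordinal.limitRecOn (motive := fun _ => Rel X) α R
    (fun _ S => S ⊓ Rel.inverseImage c c' (behLift S S))
    (fun β _ S => ⨅ (δ : Ordinal.{0}) (h : δ < β), S δ h)

/-! ### The operational models -/

/-- The substitution map `γ₀ : Λ ⟶ ⟪Λ, Λ⟫`, pointwise: `u ↦ t[u]`. -/
def substOf {Γ : Ctx} {τ : Ty} (t : Tm Γ τ) : (substStr Lam Lam τ).obj Γ :=
  { app := fun _ => ↾(fun u => t.subst u)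
    naturality := fun Δ E r => by
      ext u
      exact (t.subst_rename u r).symm }

/-- The behaviour `e ↦ t[e/x]` of `λx.t`, as an element of the exponential `Λ_b^{Λ_a}(Γ)`:
at a renaming `r : Γ ⟶ Δ` and `e ∈ Λ_a(Δ)` it has the value `t[r][e/x]`. -/
def lamFun {Γ : Ctx} {a b : Ty} (t : Tm (Γ.ext a) b) :
    ((Lam a).functorHom (Lam b)).obj Γ :=
  { app := fun _ (r : Γ ⟶ _) => ↾(fun e => (t.rename (extMap r a)).inst e)
    naturality := fun {Δ E} s (r : Γ ⟶ Δ) => by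
      ext e
      refine Eq.trans ?_ (Tm.inst_rename (t.rename (extMap r a)) e s).symm
      rw [← Tm.rename_comp, ← extMap_comp]
      rfl }

/-- `Shows t d`: the term `t` is a value with behaviour `d`. -/
inductive Shows : {Γ : Ctx} → {τ : Ty} → Tm Γ τ → DObj Lam Lam Γ τ → Prop
  | lam {Γ : Ctx} {a b : Ty} (t : Tm (Γ.ext a) b) : Shows (.lam t) (.fn (lamFun t))
  | inl {Γ : Ctx} {a b : Ty} (t : Tm Γ a) : Shows (.inl (b := b) t) (.inl t)
  | inr {Γ : Ctx} {a b : Ty} (t : Tm Γ b) : Shows (.inr (a := a) t) (.inr t)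
  | pair {Γ : Ctx} {a b : Ty} (t : Tm Γ a) (s : Tm Γ b) : Shows (.pair t s) (.pair t s)
  | fold {Γ : Ctx} {τ : TyExp 1} (t : Tm Γ (unroll τ)) : Shows (.fold t) (.fold t)

/-- The transitions `γ_τ(Γ)(t)` of a term: its one-step reducts, and its behaviour as a value. -/
inductive Trans {Γ : Ctx} {τ : Ty} (t : Tm Γ τ) : (YD Lam Lam τ).obj Γ → Prop
  | step (t' : Tm Γ τ) (h : Step t t') : Trans t (.inl t')
  | val (d : DObj Lam Lam Γ τ) (h : Shows t d) : Trans t (.inr d)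

/-- The weak transitions of a term. -/
inductive WTrans {Γ : Ctx} {τ : Ty} (t : Tm Γ τ) : (YD Lam Lam τ).obj Γ → Prop
  | step (t' : Tm Γ τ) (h : Steps t t') : WTrans t (.inl t')
  | val (s : Tm Γ τ) (d : DObj Lam Lam Γ τ) (h : Steps t s) (k : Shows s d) :
      WTrans t (.inr d)

theorem lamFun_rename {Γ Δ : Ctx} {a b : Ty} (t : Tm (Γ.ext a) b) (r : Γ ⟶ Δ) :
    lamFun (t.rename (extMap r a)) = ((Lam a).functorHom (Lam b)).map r (lamFun t) := by
  apply Functor.functorHom_ext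
  intro E s
  ext e
  change ((t.rename (extMap r a)).rename (extMap s a)).inst e =
    (t.rename (extMap (r ≫ s) a)).inst e
  rw [extMap_comp, Tm.rename_comp]

theorem Shows.rename {Γ Δ : Ctx} {τ : Ty} {t : Tm Γ τ} {d : DObj Lam Lam Γ τ}
    (h : Shows t d) (r : Γ ⟶ Δ) : Shows (t.rename r) (d.rename r) := by
  cases h with
  | lam t =>
    change Shows (.lam (t.rename (extMap r _))) (.fn _)
    rw [← lamFun_rename]
    exact .lam _
  | _ => constructor

theorem Shows.of_rename {Γ Δ : Ctx} {τ : Ty} (t : Tm Γ τ) (r : Γ ⟶ Δ) (d : DObj Lam Lam Δ τ)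
    (h : Shows (t.rename r) d) : ∃ d', Shows t d' ∧ d'.rename r = d := by
  cases t with
  | lam t =>
    cases h
    exact ⟨_, .lam t, congrArg DObj.fn (lamFun_rename t r).symm⟩
  | inl t => cases h; exact ⟨_, .inl t, rfl⟩
  | inr t => cases h; exact ⟨_, .inr t, rfl⟩
  | pair t s => cases h; exact ⟨_, .pair t s, rfl⟩
  | fold t => cases h; exact ⟨_, .fold t, rfl⟩
  | _ => simp only [Tm.rename] at h; cases h

theorem substOf_rename {Γ Δ : Ctx} {τ : Ty} (t : Tm Γ τ) (r : Γ ⟶ Δ) :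
    substOf (t.rename r) = (substStr Lam Lam τ).map r (substOf t) := by
  apply NatTrans.ext
  funext E
  ext u
  exact t.rename_subst r u

/-- The operational model `⟨γ₀, γ⟩ : Λ ⟶ B(Λ, Λ)`. -/
def model : Lam ⟶ Beh Lam Lam := fun τ =>
  { app := fun Γ => ↾(fun t => (substOf t, {b | Trans t b}))
    naturality := fun Γ Δ r => by
      ext t
      refine Prod.ext (substOf_rename t r) (Set.ext fun b => ?_)
      · constructor
        · rintro (⟨p, h⟩ | ⟨d, h⟩)
          · obtain ⟨t', h1, rfl⟩ := Step.of_rename _ _ _ h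
            exact ⟨_, Trans.step t' h1, rfl⟩
          · obtain ⟨d', h1, rfl⟩ := Shows.of_rename _ _ _ h
            exact ⟨_, Trans.val d' h1, rfl⟩
        · rintro ⟨_, ⟨p, h⟩ | ⟨d, h⟩, rfl⟩
          · exact Trans.step _ (h.rename r)
          · exact Trans.val _ (h.rename r) }

/-- The weak operational model `⟨γ₀, γ̃⟩ : Λ ⟶ B(Λ, Λ)`. -/
def weakModel : Lam ⟶ Beh Lam Lam := fun τ =>
  { app := fun Γ => ↾(fun t => (substOf t, {b | WTrans t b}))
    naturality := fun Γ Δ r => by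
      ext t
      refine Prod.ext (substOf_rename t r) (Set.ext fun b => ?_)
      · constructor
        · rintro (⟨p, h⟩ | ⟨s, d, h, k⟩)
          · obtain ⟨t', h1, rfl⟩ := Steps.of_rename _ _ _ h
            exact ⟨_, WTrans.step t' h1, rfl⟩
          · obtain ⟨s', h1, rfl⟩ := Steps.of_rename _ _ _ h
            obtain ⟨d', h2, rfl⟩ := Shows.of_rename _ _ _ k
            exact ⟨_, WTrans.val s' d' h1 h2, rfl⟩
        · rintro ⟨_, ⟨p, h⟩ | ⟨s, d, h, k⟩, rfl⟩
          · exact WTrans.step _ (h.rename r)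
          · exact WTrans.val _ _ (h.rename r) (k.rename r) }

/-- The generic step-indexed logical relation of FPC. -/
noncomputable def logRel (α : Ordinal.{0}) : Rel Lam := henceforth model weakModel ⊤ α

/-! ### The logical relation in explicit terms -/

/-- Families of relations on the sets of terms. -/
abbrev TmRel : Type := ∀ (Γ : Ctx) (τ : Ty), Tm Γ τ → Tm Γ τ → Prop

def SRel (Q R : TmRel) : TmRel := fun Γ τ t s =>
  ∀ (Δ : Ctx) (u v : Sub Γ Δ), (∀ x : Fin Γ.len, Q Δ (Γ.ty x) (u x) (v x)) →
    R Δ τ (t.subst u) (s.subst v)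

def ERel (R : TmRel) : TmRel := fun Γ τ t s =>
  ∀ t', Step t t' → ∃ s', Steps s s' ∧ R Γ τ t' s'

def VRel (Q R : TmRel) : TmRel
  | _, .var i, _, _ => i.elim0
  | Γ, .sum a b, t, s =>
      (∀ t', t = .inl t' → ∃ s', Steps s (.inl s') ∧ R Γ a t' s') ∧
      (∀ t', t = .inr t' → ∃ s', Steps s (.inr s') ∧ R Γ b t' s')
  | Γ, .prod a b, t, s =>
      ∀ t₁ t₂, t = .pair t₁ t₂ → ∃ s₁ s₂, Steps s (.pair s₁ s₂) ∧ R Γ a t₁ s₁ ∧ R Γ b t₂ s₂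
  | Γ, .mu τ, t, s =>
      ∀ t', t = .fold t' → ∃ s', Steps s (.fold s') ∧ R Γ (unroll τ) t' s'
  | Γ, .arr a b, t, s =>
      ∀ e e', Q Γ a e e' → ∀ t', t = .lam t' →
        ∃ s', Steps s (.lam s') ∧ R Γ b (t'.inst e) (s'.inst e')

/-- The relations `ℒ^α` in explicit terms: `ℒ^0 = ⊤`,
`ℒ^(α+1) = ℒ^α ∩ 𝒮(ℒ^α, ℒ^α) ∩ ℰ(ℒ^α) ∩ 𝒱(ℒ^α, ℒ^α)`, and intersections at limits. -/
noncomputable def explicitLogRel (α : Ordinal.{0}) : TmRel :=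
  Ordinal.limitRecOn (motive := fun _ => TmRel) α ⊤
    (fun _ L => L ⊓ SRel L L ⊓ ERel L ⊓ VRel L L)
    (fun β _ L => ⨅ (δ : Ordinal.{0}) (h : δ < β), L δ h)

/-! ### The contextual preorder -/

/-- The observation relation `O` of may-termination: `t⇓` implies `s⇓`. -/
def mayTermination : Rel Lam := fun τ =>
  { obj := fun Γ => {p : Tm Γ τ × Tm Γ τ | Terminates p.1 → Terminates p.2}
    map := fun r p hp h =>
      (terminates_rename p.2 r).2 (hp ((terminates_rename p.1 r).1 h)) }

/-- `P` is the contextual preorder with respect to `O`: the greatest congruence on the algebra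
of terms that is contained in `O`. -/
def IsContextualPreorder (O P : Rel Lam) : Prop :=
  IsGreatest {R : Rel Lam | IsCongruence Sig iota R ∧ R ≤ O} P

/-- The ordinal `2^ω`, i.e. the initial ordinal of the cardinality of the continuum. -/
noncomputable def twoPowOmega : Ordinal.{0} := Cardinal.continuum.{0}.ord

end FPC

namespace FPC

/-! ### Composition of substitutions -/

/-! A congruence on the term algebra is a family compatible with all operations, and compatibility
is proved for every stage by transfinite induction. Limits are intersections, so all the work lies
in the successor step, `Compatible.refine`, which serves both logical relations. A reduction of a
compound term either takes place inside the evaluation position, where the simulation clause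
supplies a matching weak reduction, or is a redex contraction, where the value clause turns the
other term into a redex of the same shape, again by weak reduction in the evaluation position. In
both cases the results are related at the previous stage because that stage is compatible.
Compatible families are reflexive, since every term is built from the operations.

The delicate operation is abstraction, whose substitution clause passes under a binder. The generic
stages are subfunctors, so substitutions stay related when weakened, and the lifted substitutions
can be used. The explicit stages are not known to be closed under renaming: their arrow clause looks
at one context only, and a renaming, being a substitution of variables, costs one stage. There
`explicitLogRel_lam_subst` argues by induction on the stage and uses `t[u.lift][e] = t[u, e]` to
avoid weakening altogether. At a limit ordinal the loss of one stage is harmless, and the explicit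
family becomes a relation on `Λ`.

The contextual preorder is the transitive hull of the union of all congruences inside `O`;
transitivity is what allows the arguments of an operation to be replaced one at a time. For
soundness it then suffices that the logical relations lie in `O`. The finite stages already ensure
this: a terminating reduction of `t` is followed step by step, each step consuming one stage and the
final value one more. At arrow types the value clause speaks only about related arguments, so it has
content because every type is inhabited, through self-application at a recursive type. -/

theorem Tm.subst_cast {Γ Δ : Ctx} {σ τ : Ty} (h : σ = τ) (t : Tm Γ σ) (u : Sub Γ Δ) :
    (h ▸ t : Tm Γ τ).subst u = h ▸ t.subst u := by
  subst h; rfl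

theorem Sub.lift_ofRen {Γ Δ : Ctx} (r : Γ ⟶ Δ) (a : Ty) :
    (Sub.ofRen r).lift a = Sub.ofRen (extMap r a) := by
  funext x
  refine Fin.cases ?_ (fun x => ?_) x <;> rfl

theorem Tm.rename_eq_subst {Γ Δ : Ctx} {τ : Ty} (t : Tm Γ τ) (r : Γ ⟶ Δ) :
    t.rename r = t.subst (Sub.ofRen r) := by
  induction t generalizing Δ with
  | var x => obtain ⟨x, rfl⟩ := x; rfl
  | _ => simp_all [Tm.rename, Tm.subst, Sub.lift_ofRen]

theorem Tm.subst_id {Γ : Ctx} {τ : Ty} (t : Tm Γ τ) : t.subst (Sub.ofRen (𝟙 Γ)) = t := by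
  rw [← Tm.rename_eq_subst, Tm.rename_id]

/-- Composition of substitutions. -/
def Sub.comp {Γ Δ E : Ctx} (u : Sub Γ Δ) (v : Sub Δ E) : Sub Γ E := fun x => (u x).subst v

theorem Sub.lift_comp {Γ Δ E : Ctx} (u : Sub Γ Δ) (v : Sub Δ E) (a : Ty) :
    (u.lift a).comp (v.lift a) = (u.comp v).lift a := by
  funext x
  refine Fin.cases ?_ (fun x => ?_) x
  · rfl
  · change ((u x).rename (wk Δ a)).subst (v.lift a) = ((u x).subst v).rename (wk E a)
    rw [Tm.rename_subst, Tm.subst_rename]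
    rfl

theorem Tm.subst_subst {Γ Δ E : Ctx} {τ : Ty} (t : Tm Γ τ) (u : Sub Γ Δ) (v : Sub Δ E) :
    (t.subst u).subst v = t.subst (u.comp v) := by
  induction t generalizing Δ E with
  | var x => exact Tm.subst_cast _ _ _
  | _ => simp_all [Tm.subst, Sub.lift_comp]

/-- The weakening inside `u.lift` is cancelled by the instantiation. Through this identity the value
clause of a substituted abstraction follows from the substitution clause of its body, with no need
for weakened copies of `u` to be related. -/
theorem Tm.inst_lift {Γ Δ : Ctx} {a b : Ty} (t : Tm (Γ.ext a) b) (u : Sub Γ Δ) (e : Tm Δ a) :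
    (t.subst (u.lift a)).inst e = t.subst (u.snoc e) := by
  unfold Tm.inst
  rw [Tm.subst_subst]
  congr 1
  funext x
  refine Fin.cases ?_ (fun x => ?_) x
  · rfl
  · change ((u x).rename (wk Δ a)).subst _ = u x
    rw [Tm.rename_subst]
    exact (u x).subst_id

theorem Tm.lam_subst_lift_id {Γ : Ctx} {a b : Ty} (t : Tm (Γ.ext a) b) :
    Tm.lam (t.subst ((Sub.ofRen (𝟙 Γ)).lift a)) = .lam t := by
  rw [Sub.lift_ofRen, extMap_id, Tm.subst_id]

/-! ### Compatible families of relations -/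

/-- Compatibility of a family of relations on terms with all operations. -/
structure Compatible (R : TmRel) : Prop where
  var {Γ : Ctx} {τ : Ty} (x : Var Γ τ) : R Γ τ (.var x) (.var x)
  choice {Γ : Ctx} {τ : Ty} {t t' s s' : Tm Γ τ} :
    R Γ τ t t' → R Γ τ s s' → R Γ τ (.choice t s) (.choice t' s')
  app {Γ : Ctx} {a b : Ty} {t t' : Tm Γ (.arr a b)} {s s' : Tm Γ a} :
    R Γ _ t t' → R Γ _ s s' → R Γ _ (.app t s) (.app t' s')
  lam {Γ : Ctx} {a b : Ty} {t t' : Tm (Γ.ext a) b} :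
    R _ _ t t' → R Γ _ (.lam t) (.lam t')
  inl {Γ : Ctx} {a b : Ty} {t t' : Tm Γ a} :
    R Γ _ t t' → R Γ (.sum a b) (.inl t) (.inl t')
  inr {Γ : Ctx} {a b : Ty} {t t' : Tm Γ b} :
    R Γ _ t t' → R Γ (.sum a b) (.inr t) (.inr t')
  cond {Γ : Ctx} {a b c : Ty} {t t' : Tm Γ (.sum a b)} {s s' : Tm Γ (.arr a c)}
    {r r' : Tm Γ (.arr b c)} : R Γ _ t t' → R Γ _ s s' → R Γ _ r r' →
    R Γ _ (.cond t s r) (.cond t' s' r')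
  pair {Γ : Ctx} {a b : Ty} {t t' : Tm Γ a} {s s' : Tm Γ b} :
    R Γ _ t t' → R Γ _ s s' → R Γ _ (.pair t s) (.pair t' s')
  fst {Γ : Ctx} {a b : Ty} {t t' : Tm Γ (.prod a b)} :
    R Γ _ t t' → R Γ _ (.fst t) (.fst t')
  snd {Γ : Ctx} {a b : Ty} {t t' : Tm Γ (.prod a b)} :
    R Γ _ t t' → R Γ _ (.snd t) (.snd t')
  fold {Γ : Ctx} {τ : TyExp 1} {t t' : Tm Γ (unroll τ)} :
    R Γ _ t t' → R Γ (.mu τ) (.fold t) (.fold t')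
  unfold {Γ : Ctx} {σ : Ty} (τ : TyExp 1) (h : unroll τ = σ) {t t' : Tm Γ (.mu τ)} :
    R Γ _ t t' → R Γ σ (.unfold τ h t) (.unfold τ h t')

/-- Variables count as operations, so structural induction on the term applies without a separate
base case. -/
theorem Compatible.refl {R : TmRel} (hR : Compatible R) {Γ : Ctx} {τ : Ty} (t : Tm Γ τ) :
    R Γ τ t t := by
  induction t with
  | var x => exact hR.var x
  | choice _ _ h k => exact hR.choice h k
  | app _ _ h k => exact hR.app h k
  | lam _ h => exact hR.lam h
  | inl _ h => exact hR.inl h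
  | inr _ h => exact hR.inr h
  | cond _ _ _ h k l => exact hR.cond h k l
  | pair _ _ h k => exact hR.pair h k
  | fst _ h => exact hR.fst h
  | snd _ h => exact hR.snd h
  | fold _ h => exact hR.fold h
  | unfold τ e _ h => exact hR.unfold τ e h

theorem compatible_top : Compatible ⊤ := by
  constructor <;> intros <;> trivial

theorem TmRel.iInf_apply {ι : Sort*} (R : ι → TmRel) {Γ : Ctx} {τ : Ty} {t s : Tm Γ τ} :
    (⨅ i, R i) Γ τ t s ↔ ∀ i, R i Γ τ t s := by
  simp [_root_.iInf_apply]

theorem compatible_iInf {ι : Sort*} {R : ι → TmRel} (hR : ∀ i, Compatible (R i)) :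
    Compatible (⨅ i, R i) := by
  constructor <;> intros <;> simp only [TmRel.iInf_apply] at * <;> intro i
  · exact (hR i).var _
  · next h k => exact (hR i).choice (h i) (k i)
  · next h k => exact (hR i).app (h i) (k i)
  · next h => exact (hR i).lam (h i)
  · next h => exact (hR i).inl (h i)
  · next h => exact (hR i).inr (h i)
  · next h k l => exact (hR i).cond (h i) (k i) (l i)
  · next h k => exact (hR i).pair (h i) (k i)
  · next h => exact (hR i).fst (h i)
  · next h => exact (hR i).snd (h i)
  · next h => exact (hR i).fold (h i)
  · next h => exact (hR i).unfold _ _ (h i)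

/-! ### Weak reduction in evaluation contexts -/

theorem Steps.app {Γ : Ctx} {a b : Ty} {t t' : Tm Γ (.arr a b)} (h : Steps t t') (s : Tm Γ a) :
    Steps (.app t s) (.app t' s) :=
  Relation.ReflTransGen.lift (fun t => Tm.app t s) (fun _ _ h => Step.app h) _ _ h

theorem Steps.unfold {Γ : Ctx} {σ : Ty} {τ : TyExp 1} (e : unroll τ = σ) {t t' : Tm Γ (.mu τ)}
    (h : Steps t t') : Steps (.unfold τ e t) (.unfold τ e t') :=
  Relation.ReflTransGen.lift (fun t => Tm.unfold τ e t) (fun _ _ h => Step.unfold h) _ _ h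

theorem Steps.fst {Γ : Ctx} {a b : Ty} {t t' : Tm Γ (.prod a b)} (h : Steps t t') :
    Steps (.fst t) (.fst t') :=
  Relation.ReflTransGen.lift (fun t => Tm.fst t) (fun _ _ h => Step.fst h) _ _ h

theorem Steps.snd {Γ : Ctx} {a b : Ty} {t t' : Tm Γ (.prod a b)} (h : Steps t t') :
    Steps (.snd t) (.snd t') :=
  Relation.ReflTransGen.lift (fun t => Tm.snd t) (fun _ _ h => Step.snd h) _ _ h

theorem Steps.cond {Γ : Ctx} {a b c : Ty} {t t' : Tm Γ (.sum a b)} (h : Steps t t')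
    (s : Tm Γ (.arr a c)) (r : Tm Γ (.arr b c)) : Steps (.cond t s r) (.cond t' s r) :=
  Relation.ReflTransGen.lift (fun t => Tm.cond t s r) (fun _ _ h => Step.cond h) _ _ h

/-! ### One step of the logical relation preserves compatibility -/

/-- If `L` is compatible, then so is its refinement by substitution closure, simulation of
reduction and a relation `V` on values that implies `VRel L L`. -/
theorem Compatible.refine {L V : TmRel} (hL : Compatible L) (hV : V ≤ VRel L L)
    (nonvalue : ∀ {Γ : Ctx} {τ : Ty} {t s : Tm Γ τ}, ¬ IsValue t → V Γ τ t s)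
    (inl : ∀ {Γ : Ctx} {a b : Ty} {t s : Tm Γ a}, L Γ a t s → V Γ (.sum a b) (.inl t) (.inl s))
    (inr : ∀ {Γ : Ctx} {a b : Ty} {t s : Tm Γ b}, L Γ b t s → V Γ (.sum a b) (.inr t) (.inr s))
    (pair : ∀ {Γ : Ctx} {a b : Ty} {t t' : Tm Γ a} {s s' : Tm Γ b}, L Γ a t t' → L Γ b s s' →
      V Γ (.prod a b) (.pair t s) (.pair t' s'))
    (fold : ∀ {Γ : Ctx} {τ : TyExp 1} {t s : Tm Γ (unroll τ)}, L Γ _ t s →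
      V Γ (.mu τ) (.fold t) (.fold s))
    (lam : ∀ {Γ : Ctx} {a b : Ty} {t s : Tm (Γ.ext a) b}, (L ⊓ SRel L L) _ _ t s →
      (SRel L L ⊓ V) Γ (.arr a b) (.lam t) (.lam s)) :
    Compatible (L ⊓ SRel L L ⊓ ERel L ⊓ V) where
  var x := by
    refine ⟨⟨⟨hL.var x, fun Δ u v h => ?_⟩, ?_⟩, nonvalue (by rintro ⟨⟩)⟩
    · obtain ⟨x, rfl⟩ := x
      exact h x
    · rintro _ ⟨⟩
  choice := by
    rintro Γ τ t t' s s' ⟨⟨⟨h, hS⟩, -⟩, -⟩ ⟨⟨⟨k, kS⟩, -⟩, -⟩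
    refine ⟨⟨⟨hL.choice h k, fun Δ u v i => hL.choice (hS Δ u v i) (kS Δ u v i)⟩, ?_⟩,
      nonvalue (by rintro ⟨⟩)⟩
    intro p hp
    cases hp with
    | choiceLeft => exact ⟨_, .single .choiceLeft, h⟩
    | choiceRight => exact ⟨_, .single .choiceRight, k⟩
  app := by
    rintro Γ a b t t' s s' ⟨⟨⟨h, hS⟩, hE⟩, hv⟩ ⟨⟨⟨k, kS⟩, -⟩, -⟩
    refine ⟨⟨⟨hL.app h k, fun Δ u v i => hL.app (hS Δ u v i) (kS Δ u v i)⟩, ?_⟩,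
      nonvalue (by rintro ⟨⟩)⟩
    intro p hp
    cases hp with
    | app hp =>
      obtain ⟨q, hq, l⟩ := hE _ hp
      exact ⟨_, hq.app s', hL.app l k⟩
    | beta =>
      -- The value clause, taken at the related arguments `s` and `s'`, relates precisely the two
      -- contracta.
      obtain ⟨q, hq, l⟩ := hV _ _ _ _ hv s s' k _ rfl
      exact ⟨_, .tail (hq.app s') .beta, l⟩
  lam := by
    rintro Γ a b t t' ⟨⟨h, -⟩, -⟩
    -- Both clauses that look under the binder come from the hypothesis `lam`: this is where the
    -- generic and the explicit relation need different arguments.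
    refine ⟨⟨⟨hL.lam h.1, (lam h).1⟩, ?_⟩, (lam h).2⟩
    rintro _ ⟨⟩
  inl := by
    rintro Γ a b t t' ⟨⟨⟨h, hS⟩, -⟩, -⟩
    refine ⟨⟨⟨hL.inl h, fun Δ u v i => hL.inl (hS Δ u v i)⟩, ?_⟩, inl h⟩
    rintro _ ⟨⟩
  inr := by
    rintro Γ a b t t' ⟨⟨⟨h, hS⟩, -⟩, -⟩
    refine ⟨⟨⟨hL.inr h, fun Δ u v i => hL.inr (hS Δ u v i)⟩, ?_⟩, inr h⟩
    rintro _ ⟨⟩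
  cond := by
    rintro Γ a b c t t' s s' r r' ⟨⟨⟨h, hS⟩, hE⟩, hv⟩ ⟨⟨⟨k, kS⟩, -⟩, -⟩ ⟨⟨⟨l, lS⟩, -⟩, -⟩
    refine ⟨⟨⟨hL.cond h k l,
      fun Δ u v i => hL.cond (hS Δ u v i) (kS Δ u v i) (lS Δ u v i)⟩, ?_⟩,
      nonvalue (by rintro ⟨⟩)⟩
    intro p hp
    cases hp with
    | cond hp =>
      obtain ⟨q, hq, m⟩ := hE _ hp
      exact ⟨_, hq.cond s' r', hL.cond m k l⟩
    | condInl =>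
      -- The contracta are applications of the branches, so compatibility of `L` with application
      -- relates them.
      obtain ⟨q, hq, m⟩ := (hV _ _ _ _ hv).1 _ rfl
      exact ⟨_, .tail (hq.cond s' r') .condInl, hL.app k m⟩
    | condInr =>
      obtain ⟨q, hq, m⟩ := (hV _ _ _ _ hv).2 _ rfl
      exact ⟨_, .tail (hq.cond s' r') .condInr, hL.app l m⟩
  pair := by
    rintro Γ a b t t' s s' ⟨⟨⟨h, hS⟩, -⟩, -⟩ ⟨⟨⟨k, kS⟩, -⟩, -⟩
    refine ⟨⟨⟨hL.pair h k, fun Δ u v i => hL.pair (hS Δ u v i) (kS Δ u v i)⟩, ?_⟩, pair h k⟩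
    rintro _ ⟨⟩
  fst := by
    rintro Γ a b t t' ⟨⟨⟨h, hS⟩, hE⟩, hv⟩
    refine ⟨⟨⟨hL.fst h, fun Δ u v i => hL.fst (hS Δ u v i)⟩, ?_⟩, nonvalue (by rintro ⟨⟩)⟩
    intro p hp
    cases hp with
    | fst hp =>
      obtain ⟨q, hq, m⟩ := hE _ hp
      exact ⟨_, hq.fst, hL.fst m⟩
    | fstPair =>
      obtain ⟨q, q', hq, m, -⟩ := hV _ _ _ _ hv _ _ rfl
      exact ⟨_, .tail hq.fst .fstPair, m⟩
  snd := by
    rintro Γ a b t t' ⟨⟨⟨h, hS⟩, hE⟩, hv⟩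
    refine ⟨⟨⟨hL.snd h, fun Δ u v i => hL.snd (hS Δ u v i)⟩, ?_⟩, nonvalue (by rintro ⟨⟩)⟩
    intro p hp
    cases hp with
    | snd hp =>
      obtain ⟨q, hq, m⟩ := hE _ hp
      exact ⟨_, hq.snd, hL.snd m⟩
    | sndPair =>
      obtain ⟨q, q', hq, -, m⟩ := hV _ _ _ _ hv _ _ rfl
      exact ⟨_, .tail hq.snd .sndPair, m⟩
  fold := by
    rintro Γ τ t t' ⟨⟨⟨h, hS⟩, -⟩, -⟩
    refine ⟨⟨⟨hL.fold h, fun Δ u v i => hL.fold (hS Δ u v i)⟩, ?_⟩, fold h⟩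
    rintro _ ⟨⟩
  unfold := by
    rintro Γ σ τ e t t' ⟨⟨⟨h, hS⟩, hE⟩, hv⟩
    refine ⟨⟨⟨hL.unfold τ e h, fun Δ u v i => hL.unfold τ e (hS Δ u v i)⟩, ?_⟩,
      nonvalue (by rintro ⟨⟩)⟩
    intro p hp
    cases hp with
    | unfold hp =>
      obtain ⟨q, hq, m⟩ := hE _ hp
      exact ⟨_, hq.unfold e, hL.unfold τ e m⟩
    | unfoldFold =>
      obtain ⟨q, hq, m⟩ := hV _ _ _ _ hv _ rfl
      refine ⟨_, .tail (hq.unfold e) .unfoldFold, ?_⟩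
      subst e
      exact m

/-! ### Congruences as compatible families -/

/-- The family of relations on terms underlying a relation on `Λ`. -/
def Rel.fam (R : Rel Lam) : TmRel := fun Γ τ t s => (t, s) ∈ (R τ).obj Γ

theorem Rel.fam_rename {R : Rel Lam} {Γ Δ : Ctx} {τ : Ty} {t s : Tm Γ τ}
    (h : R.fam Γ τ t s) (r : Γ ⟶ Δ) : R.fam Δ τ (t.rename r) (s.rename r) :=
  (R τ).map r h

theorem isCongruence_iff_forall {R : Rel Lam} :
    IsCongruence Sig iota R ↔ ∀ (Γ : Ctx) (τ : Ty) (x : SigObj R.carrier Γ τ),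
      R.fam Γ τ (SigObj.map R.left x).toTm (SigObj.map R.right x).toTm := by
  constructor
  · intro h Γ τ x
    exact h τ Γ ⟨_, ⟨x, rfl⟩, rfl⟩
  · rintro h τ Γ _ ⟨_, ⟨x, rfl⟩, rfl⟩
    exact h Γ τ x

/-- An element of `Σ R` is an operation whose arguments are pairs of related terms, so a case
distinction on it yields the compatibility clauses one by one. -/
theorem isCongruence_iff {R : Rel Lam} : IsCongruence Sig iota R ↔ Compatible R.fam := by
  rw [isCongruence_iff_forall]
  constructor
  · intro H
    constructor
    · intro Γ τ x
      exact H Γ τ (.var x)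
    · intro Γ τ t t' s s' h k
      exact H Γ τ (.choice ⟨_, h⟩ ⟨_, k⟩)
    · intro Γ a b t t' s s' h k
      exact H Γ b (.app (a := a) ⟨_, h⟩ ⟨_, k⟩)
    · intro Γ a b t t' h
      exact H Γ _ (.lam (a := a) (b := b) ⟨_, h⟩)
    · intro Γ a b t t' h
      exact H Γ _ (.inl (a := a) (b := b) ⟨_, h⟩)
    · intro Γ a b t t' h
      exact H Γ _ (.inr (a := a) (b := b) ⟨_, h⟩)
    · intro Γ a b c t t' s s' r r' h k l
      exact H Γ c (.cond (a := a) (b := b) ⟨_, h⟩ ⟨_, k⟩ ⟨_, l⟩)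
    · intro Γ a b t t' s s' h k
      exact H Γ _ (.pair (a := a) (b := b) ⟨_, h⟩ ⟨_, k⟩)
    · intro Γ a b t t' h
      exact H Γ _ (.fst (a := a) (b := b) ⟨_, h⟩)
    · intro Γ a b t t' h
      exact H Γ _ (.snd (a := a) (b := b) ⟨_, h⟩)
    · intro Γ τ t t' h
      exact H Γ _ (.fold (τ := τ) ⟨_, h⟩)
    · intro Γ σ τ e t t' h
      exact H Γ σ (.unfold τ e ⟨_, h⟩)
  · intro H Γ τ x
    cases x with
    | var x => exact H.var x
    | choice t s => exact H.choice t.2 s.2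
    | app t s => exact H.app t.2 s.2
    | lam t => exact H.lam t.2
    | inl t => exact H.inl t.2
    | inr t => exact H.inr t.2
    | cond t s r => exact H.cond t.2 s.2 r.2
    | pair t s => exact H.pair t.2 s.2
    | fst t => exact H.fst t.2
    | snd t => exact H.snd t.2
    | fold t => exact H.fold t.2
    | unfold τ e t => exact H.unfold τ e t.2

theorem Rel.reflexive_of_compatible {R : Rel Lam} (h : Compatible R.fam) : R.Reflexive := by
  rintro τ Γ _ ⟨t, rfl⟩
  exact h.refl t

/-! ### Existence of the contextual preorder -/

/-- The reflexive transitive hull of the union of all congruences contained in `O`. -/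
def congruenceHull (O : Rel Lam) : Rel Lam := fun τ =>
  { obj := fun Γ => {p : Tm Γ τ × Tm Γ τ | Relation.ReflTransGen
      (fun t s => ∃ R : Rel Lam, (IsCongruence Sig iota R ∧ R ≤ O) ∧ R.fam Γ τ t s) p.1 p.2}
    map := fun r _ hp => Relation.ReflTransGen.lift (fun t => Tm.rename t r)
      (fun _ _ ⟨R, hR, h⟩ => ⟨R, hR, R.fam_rename h r⟩) _ _ hp }

/-- A chain is carried through `f` link by link; each link only needs its own congruence to respect
`f`. -/
theorem congruenceHull_map {O : Rel Lam} {Γ Δ : Ctx} {σ τ : Ty} (f : Tm Γ σ → Tm Δ τ)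
    (hf : ∀ R : Rel Lam, Compatible R.fam → ∀ t s, R.fam Γ σ t s → R.fam Δ τ (f t) (f s))
    {t s : Tm Γ σ} (h : (congruenceHull O).fam Γ σ t s) :
    (congruenceHull O).fam Δ τ (f t) (f s) :=
  Relation.ReflTransGen.lift f
    (fun _ _ ⟨R, hR, h⟩ => ⟨R, hR, hf R (isCongruence_iff.1 hR.1) _ _ h⟩) _ _ h

theorem congruenceHull_trans {O : Rel Lam} {Γ : Ctx} {τ : Ty} {t s r : Tm Γ τ}
    (h : (congruenceHull O).fam Γ τ t s) (k : (congruenceHull O).fam Γ τ s r) :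
    (congruenceHull O).fam Γ τ t r :=
  Relation.ReflTransGen.trans h k

/-- The union of the congruences would not suffice, since two arguments of an operation may be
related by different congruences. In the hull the arguments are changed one after another, the
remaining ones being held fixed by reflexivity. -/
theorem compatible_congruenceHull (O : Rel Lam) : Compatible (congruenceHull O).fam where
  var _ := Relation.ReflTransGen.refl
  choice {_ _ _ t' s _} h k := congruenceHull_trans
    (congruenceHull_map (fun t => .choice t s) (fun _ hR _ _ h => hR.choice h (hR.refl _)) h)
    (congruenceHull_map (fun s => .choice t' s) (fun _ hR _ _ h => hR.choice (hR.refl _) h) k)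
  app {_ _ _ _ t' s _} h k := congruenceHull_trans
    (congruenceHull_map (fun t => .app t s) (fun _ hR _ _ h => hR.app h (hR.refl _)) h)
    (congruenceHull_map (fun s => .app t' s) (fun _ hR _ _ h => hR.app (hR.refl _) h) k)
  lam h := congruenceHull_map (fun t => .lam t) (fun _ hR _ _ h => hR.lam h) h
  inl h := congruenceHull_map (fun t => .inl t) (fun _ hR _ _ h => hR.inl h) h
  inr h := congruenceHull_map (fun t => .inr t) (fun _ hR _ _ h => hR.inr h) h
  cond {_ _ _ _ _ t' s s' r _} h k l := congruenceHull_trans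
    (congruenceHull_map (fun t => .cond t s r)
      (fun _ hR _ _ h => hR.cond h (hR.refl _) (hR.refl _)) h)
    (congruenceHull_trans
      (congruenceHull_map (fun s => .cond t' s r)
        (fun _ hR _ _ h => hR.cond (hR.refl _) h (hR.refl _)) k)
      (congruenceHull_map (fun r => .cond t' s' r)
        (fun _ hR _ _ h => hR.cond (hR.refl _) (hR.refl _) h) l))
  pair {_ _ _ _ t' s _} h k := congruenceHull_trans
    (congruenceHull_map (fun t => .pair t s) (fun _ hR _ _ h => hR.pair h (hR.refl _)) h)
    (congruenceHull_map (fun s => .pair t' s) (fun _ hR _ _ h => hR.pair (hR.refl _) h) k)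
  fst h := congruenceHull_map (fun t => .fst t) (fun _ hR _ _ h => hR.fst h) h
  snd h := congruenceHull_map (fun t => .snd t) (fun _ hR _ _ h => hR.snd h) h
  fold h := congruenceHull_map (fun t => .fold t) (fun _ hR _ _ h => hR.fold h) h
  unfold τ e _ _ h :=
    congruenceHull_map (fun t => .unfold τ e t) (fun _ hR _ _ h => hR.unfold τ e h) h

/-- Since `O` is a preorder, chains of links inside `O` stay inside `O`; any competing congruence
embeds as chains of length one. -/
theorem isContextualPreorder_congruenceHull {O : Rel Lam}
    (refl : ∀ {Γ : Ctx} {τ : Ty} (t : Tm Γ τ), O.fam Γ τ t t)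
    (trans : ∀ {Γ : Ctx} {τ : Ty} {t s r : Tm Γ τ},
      O.fam Γ τ t s → O.fam Γ τ s r → O.fam Γ τ t r) :
    IsContextualPreorder O (congruenceHull O) := by
  refine ⟨⟨isCongruence_iff.2 (compatible_congruenceHull O), ?_⟩, ?_⟩
  · rintro τ Γ ⟨t, s⟩ h
    change Relation.ReflTransGen _ t s at h
    induction h with
    | refl => exact refl t
    | tail _ h ih =>
      obtain ⟨R, hR, h⟩ := h
      exact trans ih (hR.2 τ Γ h)
  · intro R hR τ Γ p h
    exact Relation.ReflTransGen.single ⟨R, hR, h⟩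

/-! ### The generic logical relation -/

/-- Values of the first term are matched, up to weak reduction, by values of the second term
with related behaviour. -/
def GRel (R : Rel Lam) : TmRel := fun Γ τ t s =>
  ∀ d : DObj Lam Lam Γ τ, Shows t d →
    ∃ (s' : Tm Γ τ) (d' : DObj Lam Lam Γ τ), Steps s s' ∧ Shows s' d' ∧ DRel R R Γ d d'

/-- `YDRel` never relates a reduct to a value behaviour, so the Egli–Milner condition splits into a
simulation of steps and a matching of values. -/
theorem fam_inverseImage_behLift (R : Rel Lam) :
    (Rel.inverseImage model weakModel (behLift R R)).fam =
      SRel R.fam R.fam ⊓ ERel R.fam ⊓ GRel R := by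
  funext Γ τ t s
  refine propext ⟨?_, ?_⟩
  · rintro ⟨hS, hB⟩
    refine ⟨⟨hS, fun t' ht => ?_⟩, fun d hd => ?_⟩
    · obtain ⟨_, ⟨s', hs⟩ | ⟨s', d', hs, hd'⟩, hb⟩ := hB _ (Trans.step t' ht)
      · cases hb with | inl _ _ h => exact ⟨_, hs, h⟩
      · cases hb
    · obtain ⟨_, ⟨s', hs⟩ | ⟨s', d', hs, hd'⟩, hb⟩ := hB _ (Trans.val d hd)
      · cases hb
      · cases hb with | inr _ _ h => exact ⟨s', d', hs, hd', h⟩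
  · rintro ⟨⟨hS, hE⟩, hG⟩
    refine ⟨hS, ?_⟩
    rintro _ (⟨t', ht⟩ | ⟨d, hd⟩)
    · obtain ⟨s', hs, h⟩ := hE t' ht
      exact ⟨_, WTrans.step s' hs, .inl _ _ h⟩
    · obtain ⟨s', d', hs, hd', h⟩ := hG d hd
      exact ⟨_, WTrans.val s' d' hs hd', .inr _ _ h⟩

theorem logRel_zero : logRel 0 = ⊤ := by
  unfold logRel henceforth
  exact Ordinal.limitRecOn_zero _ _ _

theorem fam_logRel_add_one (α : Ordinal.{0}) : (logRel (α + 1)).fam =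
    (logRel α).fam ⊓ SRel (logRel α).fam (logRel α).fam ⊓ ERel (logRel α).fam ⊓
      GRel (logRel α) := by
  have h : logRel (α + 1) = logRel α ⊓ Rel.inverseImage model weakModel
      (behLift (logRel α) (logRel α)) := by
    unfold logRel henceforth
    exact Ordinal.limitRecOn_add_one _ _ _ _
  have h' : (logRel (α + 1)).fam = (logRel α).fam ⊓ (Rel.inverseImage model weakModel
      (behLift (logRel α) (logRel α))).fam := by
    rw [h]; rfl
  rw [h', fam_inverseImage_behLift, inf_assoc, inf_assoc, inf_assoc]

theorem logRel_limit {α : Ordinal.{0}} (h : Order.IsSuccLimit α) :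
    logRel α = ⨅ (δ : Ordinal.{0}) (_ : δ < α), logRel δ := by
  unfold logRel henceforth
  exact Ordinal.limitRecOn_limit _ _ _ _ h

theorem Rel.fam_iInf {ι : Sort*} (R : ι → Rel Lam) : (⨅ i, R i).fam = ⨅ i, (R i).fam := by
  funext Γ τ t s
  refine propext (Iff.trans ?_ (TmRel.iInf_apply _).symm)
  simp only [Rel.fam, iInf_apply, Subfunctor.iInf_obj]
  exact Set.mem_iInter

/-- Only arrow types need thought: relatedness in the exponential covers all renamings out of `Γ`,
and the explicit clause is its instance at the identity. -/
theorem GRel_le_VRel (R : Rel Lam) : GRel R ≤ VRel R.fam R.fam := by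
  intro Γ τ t s h
  cases τ with
  | var i => exact i.elim0
  | sum a b =>
    constructor
    · rintro t' rfl
      obtain ⟨s', d', hs, hd, hr⟩ := h _ (.inl t')
      cases hr with
      | inl _ _ h => cases hd with | inl => exact ⟨_, hs, h⟩
    · rintro t' rfl
      obtain ⟨s', d', hs, hd, hr⟩ := h _ (.inr t')
      cases hr with
      | inr _ _ h => cases hd with | inr => exact ⟨_, hs, h⟩
  | prod a b =>
    rintro t₁ t₂ rfl
    obtain ⟨s', d', hs, hd, hr⟩ := h _ (.pair t₁ t₂)
    cases hr with
    | pair _ _ _ _ h k => cases hd with | pair => exact ⟨_, _, hs, h, k⟩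
  | arr a b =>
    rintro e e' he t' rfl
    obtain ⟨s', d', hs, hd, hr⟩ := h _ (.lam t')
    cases hr with
    | fn _ _ h =>
      cases hd with
      | lam s' =>
        have := h Γ (𝟙 Γ) e e' he
        change R.fam Γ b ((t'.rename (extMap (𝟙 Γ) a)).inst e)
          ((s'.rename (extMap (𝟙 Γ) a)).inst e') at this
        rw [extMap_id, Tm.rename_id, Tm.rename_id] at this
        exact ⟨_, hs, this⟩
  | mu τ =>
    rintro t' rfl
    obtain ⟨s', d', hs, hd, hr⟩ := h _ (.fold t')
    cases hr with
    | fold _ _ h => cases hd with | fold => exact ⟨_, hs, h⟩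

theorem Shows.isValue {Γ : Ctx} {τ : Ty} {t : Tm Γ τ} {d : DObj Lam Lam Γ τ} (h : Shows t d) :
    IsValue t := by
  cases h <;> constructor

theorem TmRel.snoc {R : TmRel} {Γ Δ : Ctx} {a : Ty} {u v : Sub Γ Δ}
    (h : ∀ x, R Δ (Γ.ty x) (u x) (v x)) {e e' : Tm Δ a} (k : R Δ a e e') (x : Fin (Γ.ext a).len) :
    R Δ ((Γ.ext a).ty x) (u.snoc e x) (v.snoc e' x) := by
  refine Fin.cases ?_ (fun x => ?_) x
  · exact k
  · exact h x

/-- The value of `lamFun t` at `r` and `e` is thus a substitution instance of the body, to which the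
substitution clause of the body applies. -/
theorem Tm.inst_rename_extMap {Γ Δ : Ctx} {a b : Ty} (t : Tm (Γ.ext a) b) (r : Γ ⟶ Δ)
    (e : Tm Δ a) : (t.rename (extMap r a)).inst e = t.subst ((Sub.ofRen r).snoc e) := by
  rw [Tm.rename_eq_subst, ← Sub.lift_ofRen, Tm.inst_lift]

theorem compatible_logRel_add_one {α : Ordinal.{0}} (hL : Compatible (logRel α).fam) :
    Compatible (logRel (α + 1)).fam := by
  rw [fam_logRel_add_one]
  refine hL.refine (GRel_le_VRel _) ?_ ?_ ?_ ?_ ?_ ?_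
  · intro Γ τ t s h d hd
    exact absurd hd.isValue h
  · rintro Γ a b t s h _ ⟨⟩
    exact ⟨_, _, .refl, .inl s, .inl _ _ h⟩
  · rintro Γ a b t s h _ ⟨⟩
    exact ⟨_, _, .refl, .inr s, .inr _ _ h⟩
  · rintro Γ a b t t' s s' h k _ ⟨⟩
    exact ⟨_, _, .refl, .pair t' s', .pair _ _ _ _ h k⟩
  · rintro Γ τ t s h _ ⟨⟩
    exact ⟨_, _, .refl, .fold s, .fold _ _ h⟩
  · rintro Γ a b t s ⟨h, hS⟩
    refine ⟨fun Δ u v i => hL.lam (hS _ _ _ fun x => ?_), ?_⟩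
    -- The new variable is related to itself, and the old entries stay related after weakening
    -- because `logRel α` consists of subfunctors.
    · refine TmRel.snoc (fun x => ?_) (hL.var _) x
      exact Rel.fam_rename (i x) _
    · rintro _ ⟨⟩
      have key : ∀ (Δ : Ctx) (r : Γ ⟶ Δ) (e e' : Tm Δ a), (logRel α).fam Δ a e e' →
          (logRel α).fam Δ b ((t.rename (extMap r a)).inst e)
            ((s.rename (extMap r a)).inst e') := by
        intro Δ r e e' he
        rw [Tm.inst_rename_extMap, Tm.inst_rename_extMap]
        exact hS _ _ _ fun x => TmRel.snoc (fun x => hL.var _) he x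
      exact ⟨_, _, .refl, .lam s, .fn _ _ key⟩

theorem compatible_logRel (α : Ordinal.{0}) : Compatible (logRel α).fam := by
  induction α using Ordinal.limitRecOn with
  | zero => rw [logRel_zero]; exact compatible_top
  | add_one α ih => exact compatible_logRel_add_one ih
  | limit α h ih =>
    rw [logRel_limit h, Rel.fam_iInf]
    refine compatible_iInf fun δ => ?_
    rw [Rel.fam_iInf]
    exact compatible_iInf fun hδ => ih δ hδ

/-! ### The explicit logical relation -/

theorem explicitLogRel_zero : explicitLogRel 0 = ⊤ := Ordinal.limitRecOn_zero _ _ _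

theorem explicitLogRel_add_one (α : Ordinal.{0}) : explicitLogRel (α + 1) =
    explicitLogRel α ⊓ SRel (explicitLogRel α) (explicitLogRel α) ⊓ ERel (explicitLogRel α) ⊓
      VRel (explicitLogRel α) (explicitLogRel α) :=
  Ordinal.limitRecOn_add_one _ _ _ _

theorem explicitLogRel_limit {α : Ordinal.{0}} (h : Order.IsSuccLimit α) :
    explicitLogRel α = ⨅ (δ : Ordinal.{0}) (_ : δ < α), explicitLogRel δ :=
  Ordinal.limitRecOn_limit _ _ _ _ h

theorem explicitLogRel_limit_apply {α : Ordinal.{0}} (h : Order.IsSuccLimit α) {Γ : Ctx} {τ : Ty}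
    {t s : Tm Γ τ} : explicitLogRel α Γ τ t s ↔ ∀ δ < α, explicitLogRel δ Γ τ t s := by
  rw [explicitLogRel_limit h, TmRel.iInf_apply]
  simp only [TmRel.iInf_apply]

/-- The substitution clause for `δ` is imposed at stage `δ + 1`, and later stages only shrink. -/
theorem explicitLogRel_subst_of_lt {α δ : Ordinal.{0}} (h : δ < α) :
    explicitLogRel α ≤ SRel (explicitLogRel δ) (explicitLogRel δ) := by
  induction α using Ordinal.limitRecOn with
  | zero => exact absurd h not_lt_zero
  | add_one α ih =>
    rw [explicitLogRel_add_one]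
    rcases (Order.lt_add_one_iff.1 h).lt_or_eq with h | rfl
    · exact fun _ _ _ _ k => ih h _ _ _ _ k.1.1.1
    · exact fun _ _ _ _ k => k.1.1.2
  | limit α hα ih =>
    intro Γ τ t s k
    -- Below a limit there is room for the stage `δ + 1` at which the clause is imposed.
    have hδ := hα.add_one_lt h
    exact ih _ hδ (lt_add_one δ) _ _ _ _ ((explicitLogRel_limit_apply hα).1 k _ hδ)

/-- Induction on the stage, for all target contexts at once, with the substitutions built into the
statement. A further substitution is absorbed by composition and an argument by `Sub.snoc`, so
relatedness is only ever needed for the unweakened entries of `u` and `v`. -/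
theorem explicitLogRel_lam_subst {α : Ordinal.{0}} {Γ Δ : Ctx} {a b : Ty} {t s : Tm (Γ.ext a) b}
    (h : ∀ δ < α, SRel (explicitLogRel δ) (explicitLogRel δ) _ _ t s) {u v : Sub Γ Δ}
    (huv : ∀ x, explicitLogRel α Δ _ (u x) (v x)) :
    explicitLogRel α Δ (.arr a b) (.lam (t.subst (u.lift a))) (.lam (s.subst (v.lift a))) := by
  induction α using Ordinal.limitRecOn generalizing Δ with
  | zero => rw [explicitLogRel_zero]; trivial
  | add_one α ih =>
    have h' := fun δ (hδ : δ < α) => h δ (hδ.trans (lt_add_one α))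
    simp only [explicitLogRel_add_one] at huv ⊢
    refine ⟨⟨⟨ih h' fun x => (huv x).1.1.1, fun E u' v' k => ?_⟩, ?_⟩, ?_⟩
    · change explicitLogRel α E _ (.lam ((t.subst (u.lift a)).subst (u'.lift a)))
        (.lam ((s.subst (v.lift a)).subst (v'.lift a)))
      rw [Tm.subst_subst, Tm.subst_subst, Sub.lift_comp, Sub.lift_comp]
      -- The composites are related at stage `α` by the substitution clauses of the entries of `u`
      -- and `v`, which are related at stage `α + 1`.
      exact ih h' fun x => (huv x).1.1.2 E u' v' k
    · rintro _ ⟨⟩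
    · rintro e e' he _ ⟨⟩
      refine ⟨_, .refl, ?_⟩
      rw [Tm.inst_lift, Tm.inst_lift]
      exact h α (lt_add_one α) _ _ _ fun x => TmRel.snoc (fun x => (huv x).1.1.1) he x
  | limit α hα ih =>
    rw [explicitLogRel_limit_apply hα]
    exact fun δ hδ => ih δ hδ (fun ε hε => h ε (hε.trans hδ))
      fun x => (explicitLogRel_limit_apply hα).1 (huv x) δ hδ

theorem VRel_of_not_isValue {Q R : TmRel} {Γ : Ctx} {τ : Ty} {t s : Tm Γ τ} (h : ¬ IsValue t) :
    VRel Q R Γ τ t s := by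
  cases τ with
  | var i => exact i.elim0
  | sum a b =>
    exact ⟨fun t' e => absurd (e ▸ IsValue.inl t') h, fun t' e => absurd (e ▸ IsValue.inr t') h⟩
  | prod a b => exact fun t₁ t₂ e => absurd (e ▸ IsValue.pair t₁ t₂) h
  | arr a b => exact fun _ _ _ t' e => absurd (e ▸ IsValue.lam t') h
  | mu τ => exact fun t' e => absurd (e ▸ IsValue.fold t') h

theorem explicitLogRel_var (α : Ordinal.{0}) {Γ : Ctx} {τ : Ty} (x : Var Γ τ) :
    explicitLogRel α Γ τ (.var x) (.var x) := by
  induction α using Ordinal.limitRecOn with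
  | zero => rw [explicitLogRel_zero]; trivial
  | add_one α ih =>
    rw [explicitLogRel_add_one]
    refine ⟨⟨⟨ih, fun Δ u v h => ?_⟩, ?_⟩, VRel_of_not_isValue (by rintro ⟨⟩)⟩
    · obtain ⟨x, rfl⟩ := x
      exact h x
    · rintro _ ⟨⟩
  | limit α hα ih => exact (explicitLogRel_limit_apply hα).2 ih

theorem explicitLogRel_lam {α : Ordinal.{0}} {Γ : Ctx} {a b : Ty} {t s : Tm (Γ.ext a) b}
    (h : ∀ δ < α, SRel (explicitLogRel δ) (explicitLogRel δ) _ _ t s) :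
    explicitLogRel α Γ (.arr a b) (.lam t) (.lam s) := by
  -- Each abstraction is its own instance under the identity substitution, whose entries are
  -- variables and hence related at every stage.
  rw [← Tm.lam_subst_lift_id t, ← Tm.lam_subst_lift_id s]
  exact explicitLogRel_lam_subst h fun x => explicitLogRel_var _ _

theorem compatible_explicitLogRel (α : Ordinal.{0}) : Compatible (explicitLogRel α) := by
  induction α using Ordinal.limitRecOn with
  | zero => rw [explicitLogRel_zero]; exact compatible_top
  | add_one α ih =>
    -- The binder case needs the substitution clauses of the bodies at all stages up to `α`: the one
    -- at `α` is given, the earlier ones follow from membership in stage `α`.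
    have hlam : ∀ {Γ : Ctx} {a b : Ty} {t s : Tm (Γ.ext a) b},
        (explicitLogRel α ⊓ SRel (explicitLogRel α) (explicitLogRel α)) _ _ t s →
        explicitLogRel (α + 1) Γ (.arr a b) (.lam t) (.lam s) := by
      rintro Γ a b t s ⟨h, hS⟩
      refine explicitLogRel_lam fun δ hδ => ?_
      rcases (Order.lt_add_one_iff.1 hδ).lt_or_eq with hδ | rfl
      · exact explicitLogRel_subst_of_lt hδ _ _ _ _ h
      · exact hS
    rw [explicitLogRel_add_one] at hlam ⊢
    refine ih.refine le_rfl VRel_of_not_isValue ?_ ?_ ?_ ?_ fun h =>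
      ⟨(hlam h).1.1.2, (hlam h).2⟩
    · intro Γ a b t s h
      constructor
      · rintro _ ⟨⟩; exact ⟨s, .refl, h⟩
      · rintro _ ⟨⟩
    · intro Γ a b t s h
      constructor
      · rintro _ ⟨⟩
      · rintro _ ⟨⟩; exact ⟨s, .refl, h⟩
    · rintro Γ a b t t' s s' h k _ _ ⟨⟩
      exact ⟨t', s', .refl, h, k⟩
    · rintro Γ τ t s h _ ⟨⟩
      exact ⟨s, .refl, h⟩
  | limit α hα ih =>
    rw [explicitLogRel_limit hα]
    exact compatible_iInf fun δ => compatible_iInf fun hδ => ih δ hδ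

/-- A renaming is a substitution of variables. Applying the substitution clause lowers the stage,
but below a limit every smaller stage is still reached. -/
theorem explicitLogRel_rename {α : Ordinal.{0}} (hα : Order.IsSuccLimit α) {Γ Δ : Ctx} {τ : Ty}
    {t s : Tm Γ τ} (h : explicitLogRel α Γ τ t s) (r : Γ ⟶ Δ) :
    explicitLogRel α Δ τ (t.rename r) (s.rename r) := by
  rw [explicitLogRel_limit_apply hα]
  intro δ hδ
  rw [Tm.rename_eq_subst, Tm.rename_eq_subst]
  exact explicitLogRel_subst_of_lt hδ _ _ _ _ h _ _ _ fun x => explicitLogRel_var _ _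

/-- The relation on `Λ` given by the explicit logical relation at a limit ordinal. -/
noncomputable def explicitRel {α : Ordinal.{0}} (hα : Order.IsSuccLimit α) : Rel Lam := fun τ =>
  { obj := fun Γ => {p : Tm Γ τ × Tm Γ τ | explicitLogRel α Γ τ p.1 p.2}
    map := fun r _ h => explicitLogRel_rename hα h r }

/-! ### Adequacy -/

theorem TyExp.rename_subst {n m k : ℕ} (τ : TyExp n) (r : Fin n → Fin m)
    (s : Fin m → TyExp k) : (τ.rename r).subst s = τ.subst (fun i => s (r i)) := by
  induction τ generalizing m k with
  | mu a ih =>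
    simp only [TyExp.rename, TyExp.subst, ih]
    congr 2
    funext i
    refine Fin.cases ?_ (fun i => ?_) i <;> rfl
  | _ => simp_all [TyExp.rename, TyExp.subst]

theorem TyExp.subst_var {n : ℕ} (τ : TyExp n) : τ.subst .var = τ := by
  induction τ with
  | mu a ih =>
    rw [TyExp.subst]
    conv_rhs => rw [← ih]
    congr 2
    funext i
    refine Fin.cases ?_ (fun i => ?_) i <;> rfl
  | _ => simp_all [TyExp.subst]

theorem TyExp.weaken_subst (τ : Ty) (s : Fin 1 → Ty) : (τ.rename Fin.succ).subst s = τ := by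
  rw [TyExp.rename_subst]
  conv_rhs => rw [← τ.subst_var]
  congr 1
  funext i
  exact i.elim0

/-- Every type is inhabited, in every context, by a divergent term. -/
theorem nonempty_tm (Γ : Ctx) (τ : Ty) : Nonempty (Tm Γ τ) := by
  -- The type `μα. α ⇒ τ` unrolls to `(μα. α ⇒ τ) ⇒ τ`, which makes the self-application `ω = λx.
  -- (unfold x) x` typable.
  let σ : TyExp 1 := .arr (.var 0) (τ.rename Fin.succ)
  have h : unroll σ = .arr (.mu σ) τ := by
    change TyExp.arr (.mu σ) ((τ.rename Fin.succ).subst _) = _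
    rw [TyExp.weaken_subst]
  let x : Tm (Γ.ext (.mu σ)) (.mu σ) := .var ⟨(0 : Fin (Γ.len + 1)), rfl⟩
  let ω : Tm Γ (.arr (.mu σ) τ) := .lam (.app (.unfold σ h x) x)
  exact ⟨.app ω (.fold (h ▸ ω))⟩

/-- At arrow types the clause would be vacuous without a related pair of arguments. One is obtained
from any inhabitant by reflexivity of `Q`. -/
theorem VRel.terminates {Q R : TmRel} (hQ : Compatible Q) {Γ : Ctx} {τ : Ty} {t s : Tm Γ τ}
    (h : VRel Q R Γ τ t s) (ht : IsValue t) : Terminates s := by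
  cases ht with
  | lam t =>
    obtain ⟨e⟩ := nonempty_tm Γ _
    obtain ⟨s', hs, -⟩ := h e e (hQ.refl e) t rfl
    exact ⟨_, hs, .lam s'⟩
  | inl t =>
    obtain ⟨s', hs, -⟩ := h.1 t rfl
    exact ⟨_, hs, .inl s'⟩
  | inr t =>
    obtain ⟨s', hs, -⟩ := h.2 t rfl
    exact ⟨_, hs, .inr s'⟩
  | pair t₁ t₂ =>
    obtain ⟨s₁, s₂, hs, -⟩ := h t₁ t₂ rfl
    exact ⟨_, hs, .pair s₁ s₂⟩
  | fold t =>
    obtain ⟨s', hs, -⟩ := h t rfl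
    exact ⟨_, hs, .fold s'⟩

/-- The finite stages of a step-indexed relation detect termination. -/
theorem terminates_of_forall_nat {L : ℕ → TmRel} (compat : ∀ n, Compatible (L n))
    (reduct : ∀ n, L (n + 1) ≤ ERel (L n)) (value : ∀ n, L (n + 1) ≤ VRel (L n) (L n))
    {Γ : Ctx} {τ : Ty} {t s : Tm Γ τ} (h : ∀ n, L n Γ τ t s) (ht : Terminates t) :
    Terminates s := by
  obtain ⟨v, hv, hval⟩ := ht
  -- The stage is chosen from the reduction of `t` alone, before `s`, because the induction
  -- hypothesis is applied to a reduct of `s`.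
  suffices ∃ n, ∀ s, L n Γ τ t s → Terminates s from this.elim fun n k => k s (h n)
  clear h s
  unfold Steps at hv
  induction hv using Relation.ReflTransGen.head_induction_on with
  | refl => exact ⟨1, fun s h => VRel.terminates (compat 0) (value 0 _ _ _ _ h) hval⟩
  | head hstep _ ih =>
    obtain ⟨n, ih⟩ := ih
    refine ⟨n + 1, fun s h => ?_⟩
    obtain ⟨s', hs, k⟩ := reduct n _ _ _ _ h _ hstep
    obtain ⟨w, hw, hw'⟩ := ih s' k
    exact ⟨w, .trans hs hw, hw'⟩

theorem logRel_le_mayTermination {α : Ordinal.{0}} (hα : Order.IsSuccLimit α) :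
    logRel α ≤ mayTermination := by
  rintro τ Γ ⟨t, s⟩ h
  refine terminates_of_forall_nat (L := fun n => (logRel n).fam)
    (fun n => compatible_logRel _) ?_ ?_ fun n => ?_
  · intro n
    rw [Nat.cast_succ, fam_logRel_add_one]
    exact fun _ _ _ _ k => k.1.2
  · intro n
    rw [Nat.cast_succ, fam_logRel_add_one]
    exact fun _ _ _ _ k => GRel_le_VRel _ _ _ _ _ k.2
  · have hn : logRel α ≤ logRel n := by
      rw [logRel_limit hα]
      exact iInf₂_le (f := fun δ (_ : δ < α) => logRel δ) (n : Ordinal.{0}) (Ordinal.natCast_lt_of_isSuccLimit hα n)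
    exact hn τ Γ h

theorem explicitRel_le_mayTermination {α : Ordinal.{0}} (hα : Order.IsSuccLimit α) :
    explicitRel hα ≤ mayTermination := by
  rintro τ Γ ⟨t, s⟩ h
  refine terminates_of_forall_nat (L := fun n => explicitLogRel n)
    (fun n => compatible_explicitLogRel _) ?_ ?_
    fun n => (explicitLogRel_limit_apply hα).1 h n (Ordinal.natCast_lt_of_isSuccLimit hα n)
  · intro n
    rw [Nat.cast_succ, explicitLogRel_add_one]
    exact fun _ _ _ _ k => k.1.2
  · intro n
    rw [Nat.cast_succ, explicitLogRel_add_one]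
    exact fun _ _ _ _ k => k.2

/-- Initial ordinals of infinite cardinals are limits; no other property of `2^ω` enters the
argument. -/
theorem isSuccLimit_twoPowOmega : Order.IsSuccLimit twoPowOmega :=
  Cardinal.isSuccLimit_ord Cardinal.aleph0_le_continuum

end FPC

theorem mainTheorem11 :
    (∀ α : Ordinal.{0}, α ≤ FPC.twoPowOmega →
      FPC.IsCongruence FPC.Sig FPC.iota (FPC.logRel α) ∧ (FPC.logRel α).Reflexive) ∧
    ∃ P : FPC.Rel FPC.Lam, FPC.IsContextualPreorder FPC.mayTermination P ∧
      FPC.logRel FPC.twoPowOmega ≤ P ∧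
      ∃ L : FPC.Rel FPC.Lam,
        (∀ (Γ : FPC.Ctx) (τ : FPC.Ty) (t s : FPC.Tm Γ τ),
          (t, s) ∈ (L τ).obj Γ ↔ FPC.explicitLogRel FPC.twoPowOmega Γ τ t s) ∧
        FPC.IsCongruence FPC.Sig FPC.iota L ∧ L.Reflexive ∧ L ≤ P := by
  have hlim := FPC.isSuccLimit_twoPowOmega
  have hlog := fun α => FPC.isCongruence_iff.2 (FPC.compatible_logRel α)
  have hexp : FPC.Compatible (FPC.explicitRel hlim).fam :=
    FPC.compatible_explicitLogRel FPC.twoPowOmega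
  have hP : FPC.IsContextualPreorder FPC.mayTermination
      (FPC.congruenceHull FPC.mayTermination) :=
    FPC.isContextualPreorder_congruenceHull (fun _ h => h) (fun h k i => k (h i))
  refine ⟨fun α _ => ⟨hlog α, FPC.Rel.reflexive_of_compatible (FPC.compatible_logRel α)⟩,
    _, hP, hP.2 ⟨hlog _, FPC.logRel_le_mayTermination hlim⟩,
    FPC.explicitRel hlim, fun _ _ _ _ => Iff.rfl, FPC.isCongruence_iff.2 hexp,
    FPC.Rel.reflexive_of_compatible hexp,
    hP.2 ⟨FPC.isCongruence_iff.2 hexp, FPC.explicitRel_le_mayTermination hlim⟩⟩
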